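/- For $\Delta>0$ and $0<z<1$ let $\bar D_{\Delta\Delta\Delta\Delta}(z)$ be the one-dimensional reduced contact function $$\bar D_{\Delta\Delta\Delta\Delta}(z)=\Gamma(\Delta)^2\int_{\alpha,\beta,\gamma>0}d\alpha\,d\beta\,d\gamma\;\delta(\alpha+\beta+\gamma-1)\,\frac{(\alpha\beta\gamma)^{\Delta-1}}{\big(\alpha\gamma+\alpha\beta\,z^2+\beta\gamma\,(1-z)^2\big)^{\Delta}} .$$ Let $\Delta_\phi\ge 1$ be an integer. With $z=\frac{t}{1+t}$, define the reduced Mellin transform $$\hat M_{\Delta_\phi}(s)=\int_0^\infty dt\;\bar D_{\Delta_\phi\Delta_\phi\Delta_\phi\Delta_\phi}\big(\tfrac{t}{1+t}\big)\Big(\frac{t}{1+t}\Big)^{2\Delta_\phi}t^{-1-s},$$ and, with $(x)_n$ the rising factorial, $$P_{\Delta_\phi}(s)=2\sum_{n=0}^{\Delta_\phi-1}(-1)^n\frac{\Gamma(2n+1)\Gamma(\Delta_\phi)^4\Gamma(\Delta_\phi+n)}{\Gamma(n+1)^4\,\Gamma(\Delta_\phi-n)\,\Gamma(2(\Delta_\phi+n))}(2\Delta_\phi-s)_n(s)_n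 .$$ 1. The integral defining $\hat M_{\Delta_\phi}(s)$ converges absolutely for $0<\mathrm{Re}(s)<2\Delta_\phi$, and for every non-integer $s$ in this strip $$\hat M_{\Delta_\phi}(s)=\pi\csc(\pi s)\Big(\pi\cot(\pi s)\,P_{\Delta_\phi}(s)-\sum_{k=1}^{2\Delta_\phi-1}\frac{P_{\Delta_\phi}(k)}{s-k}\Big).$$ At the integers $m=1,\dots,2\Delta_\phi-1$ the poles of the right-hand side cancel: it tends to $\hat M_{\Delta_\phi}(m)$ as $s\to m$, $s\ne m$. 2. For all $s\in\mathbb C$, $$P_{\Delta_\phi}(s)=2\,\frac{\Gamma(\Delta_\phi)^4}{\Gamma(2\Delta_\phi)}\;{}_4F_3\big(\tfrac12,\,s,\,1-\Delta_\phi,\,2\Delta_\phi-s;\;1,\,1,\,\Delta_\phi+\tfrac12;\;1\big),$$ and $P_{\Delta_\phi}$ is a polynomial in $s$ of degree $2\Delta_\phi-2$. 3. Let $L\ge 0$ be an integer and let $$f^{(1)}_L(z)=N_L\,z^{2\Delta_\phi}\big(1+z^{2L}+(1-z)^{2L}\big)\bar D_{\Delta_\phi+L,\Delta_\phi+L,\Delta_\phi+L,\Delta_\phi+L}(z),\qquad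 N_L=\frac{4^{L-1}\pi^{-3/2}\,\Gamma(2\Delta_\phi-\frac12+2L)}{\Gamma(\Delta_\phi+\frac12)^4},$$ be the first-order (tree-level) correlator of the quartic contact interaction with $4L$ derivatives. For $0<\mathrm{Re}(s)<2\Delta_\phi$ its Mellin integral converges absolutely and $$\int_0^\infty dt\;f^{(1)}_L\big(\tfrac{t}{1+t}\big)\,t^{-1-s}=2N_L\sum_{k=0}^{2L}c_{k,L}\,\hat M_{\Delta_\phi+L}(s+k),\qquad 2c_{k,L}=\frac{\Gamma(2L+1)}{\Gamma(k+1)\Gamma(2L-k+1)}+\delta_{k,0}+\delta_{k,2L}.$$ -/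

import Mathlib

open Filter Topology MeasureTheory

noncomputable section

/-- The reduced function `D̄_{Δ₁Δ₂Δ₃Δ₄}(u, v)` as its Feynman parameter integral
`∫ dα dβ dγ δ(α+β+γ-1) α^(Δ₁-1) β^(Δ₂-1) γ^(Δ₃-1) Γ(Σ-Δ₄) Γ(Δ₄) / (αγ + αβ u + βγ v)^(Σ-Δ₄)`,
`Σ = (Δ₁+Δ₂+Δ₃+Δ₄)/2`. The delta function is used to eliminate `γ = 1 - α - β`, and
`p = (α, β)`. -/
def DbarUV (Δ₁ Δ₂ Δ₃ Δ₄ u v : ℝ) : ℝ :=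
  ∫ p in {p : ℝ × ℝ | 0 < p.1 ∧ 0 < p.2 ∧ p.1 + p.2 < 1},
    p.1 ^ (Δ₁ - 1) * p.2 ^ (Δ₂ - 1) * (1 - p.1 - p.2) ^ (Δ₃ - 1) *
      (Real.Gamma ((Δ₁ + Δ₂ + Δ₃ + Δ₄) / 2 - Δ₄) * Real.Gamma Δ₄ /
        (p.1 * (1 - p.1 - p.2) + p.1 * p.2 * u + p.2 * (1 - p.1 - p.2) * v) ^
          ((Δ₁ + Δ₂ + Δ₃ + Δ₄) / 2 - Δ₄))

/-- The one-dimensional, equal-weight function `D̄_{ΔΔΔΔ}(z)`: `u = z²`, `v = (1-z)²`. -/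
def Dbar (Δ : ℝ) (z : ℝ) : ℝ := DbarUV Δ Δ Δ Δ (z ^ 2) ((1 - z) ^ 2)

/-- `t ↦ D̄_{ΔΔΔΔ}(z) z^(2Δ)` at `z = t/(1+t)`. -/
def DbarIntegrand (Δ : ℕ) (t : ℝ) : ℂ :=
  ((Dbar Δ (t / (1 + t)) * (t / (1 + t)) ^ (2 * Δ) : ℝ) : ℂ)

/-- The reduced Mellin transform `M̂_Δ(s) = ∫₀^∞ D̄_{ΔΔΔΔ}(t) (t/(1+t))^(2Δ) t^(-1-s) dt`
(Mathlib's `mellin f w` is `∫₀^∞ t^(w-1) f(t) dt`). -/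
def Mhat (Δ : ℕ) (s : ℂ) : ℂ := mellin (DbarIntegrand Δ) (-s)

/-- `P_Δ(s)` as a finite sum; `(x)_n` is the rising factorial. -/
def PDelta (Δ : ℕ) (s : ℂ) : ℂ :=
  2 * ∑ n ∈ Finset.range Δ,
    (-1) ^ n *
      (Complex.Gamma (2 * n + 1) * Complex.Gamma Δ ^ 4 * Complex.Gamma (Δ + n) /
        (Complex.Gamma (n + 1) ^ 4 * Complex.Gamma (Δ - n) * Complex.Gamma (2 * (Δ + n)))) *
      (ascPochhammer ℂ n).eval (2 * Δ - s) * (ascPochhammer ℂ n).eval s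

/-- The (unregularized) generalized hypergeometric function with upper parameters `a` and lower
parameters `b`; Mathlib's function carries an extra factor `1 / ∏ Γ(bᵢ)`. -/
def hypergeometricF (a b : Multiset ℂ) (x : ℂ) : ℂ :=
  (b.map Complex.Gamma).prod * Complex.regularizedHGFun a b x

/-- `π csc(πs) (π cot(πs) P_Δ(s) - ∑_{k=1}^{2Δ-1} P_Δ(k)/(s-k))`. -/
def MhatClosed (Δ : ℕ) (s : ℂ) : ℂ :=
  Real.pi / Complex.sin (Real.pi * s) *
    (Real.pi * Complex.cot (Real.pi * s) * PDelta Δ s -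
      ∑ k ∈ Finset.Icc 1 (2 * Δ - 1), PDelta Δ k / (s - k))

/-- The normalization `4^(L-1) π^(-3/2) Γ(2Δ - 1/2 + 2L) / Γ(Δ + 1/2)^4`. -/
def contactNorm (Δ L : ℕ) : ℝ :=
  4 ^ ((L : ℝ) - 1) * Real.pi ^ (-(3 / 2) : ℝ) * Real.Gamma (2 * Δ - 1 / 2 + 2 * L) /
    Real.Gamma (Δ + 1 / 2) ^ 4

/-- The first-order correlator `f⁽¹⁾_L(z)` of the contact interaction with `4L` derivatives. -/
def contactCorrelator (Δ L : ℕ) (z : ℝ) : ℝ :=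
  contactNorm Δ L * z ^ (2 * Δ) * (1 + z ^ (2 * L) + (1 - z) ^ (2 * L)) * Dbar ((Δ + L : ℕ) : ℝ) z

/-- `c_{k,L}`, with `2 c_{k,L} = Γ(2L+1)/(Γ(k+1)Γ(2L-k+1)) + δ_{k,0} + δ_{k,2L}`. -/
def cCoeff (k L : ℕ) : ℝ :=
  (Real.Gamma (2 * L + 1) / (Real.Gamma (k + 1) * Real.Gamma (2 * L - k + 1)) +
    (if k = 0 then 1 else 0) + (if k = 2 * L then 1 else 0)) / 2

end

/-!
As a function of `t`, the product `D̄_{ΔΔΔΔ}(z) z ^ (2 Δ)` at `z = t / (1 + t)` is a constant times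
`t ^ (2 Δ)` times the `AdS₂` contact diagram with boundary points `t, 0, -1, ∞`. In polar
coordinates of the upper half-plane the Mellin transform of the diagram at `σ` factorizes under the
angular integral, as `∫ sin θ ^ (4 Δ - 2) q(θ) q(π - θ) dθ` over `0 < θ < π`, where `q(θ)` is the
Mellin transform of `(1 + 2 τ cos θ + τ ^ 2) ^ (-Δ)` at `σ`.

For `Δ = N + 1` and `σ = N + 1 - ν` with `0 < ν < 1`, differentiating in `θ` shows that
`sin θ ^ (2 N + 1) q(θ)` is a constant times `π / sin(π ν)` times a sine polynomial
`∑ aᵢ(ν) sin((ν + N - 2 i) θ)` whose coefficients are polynomials in `ν`. In the angular integral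
the diagonal terms give the cotangent term of the closed formula with `∑ aᵢ ^ 2` in place of `P_Δ`,
and partial fractions in `ν` reduce all the terms to residues of the same polynomial. Finally
`∑ aᵢ ^ 2` is proportional to `P_Δ`, because both are even solutions of one second-order difference
equation whose polynomial solutions form a line. Analytic continuation extends the formula from
`Δ < s < Δ + 1` to the strip.
-/

section Pochhammer

variable {R : Type*} [CommRing R]

lemma descPochhammer_succ_eval_left (n : ℕ) (x : R) :
    (descPochhammer R (n + 1)).eval x = x * (descPochhammer R n).eval (x - 1) := by
  simp [descPochhammer_succ_left, Polynomial.eval_comp]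

lemma mul_descPochhammer_eval_sub_one (n : ℕ) (x : R) :
    x * (descPochhammer R n).eval (x - 1) = (descPochhammer R n).eval x * (x - n) := by
  rw [← descPochhammer_succ_eval_left, descPochhammer_succ_eval]

lemma descPochhammer_eval_neg_sub_one (n : ℕ) (x : R) :
    (descPochhammer R n).eval (-x - 1) = (-1) ^ n * (descPochhammer R n).eval (x + n) := by
  rw [descPochhammer_eval_eq_ascPochhammer, show -x - 1 - (n : R) + 1 = -(x + n) by ring,
    ascPochhammer_eval_neg_eq_descPochhammer]

lemma cast_choose_succ_mul (n k : ℕ) :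
    (n.choose (k + 1) : R) * (k + 1) = n.choose k * (n - k) := by
  rcases le_or_gt k n with h | h
  · exact_mod_cast congrArg (Nat.cast (R := R)) (Nat.choose_succ_right_eq n k)
  · simp [Nat.choose_eq_zero_of_lt h, Nat.choose_eq_zero_of_lt (h.trans (Nat.lt_succ_self k))]

end Pochhammer

section PartialFractions

open Polynomial

lemma degree_taylor_sub_lt {R : Type*} [CommRing R] {q : R[X]} (hq : q ≠ 0) (r : R) :
    (taylor r q - q).degree < q.degree :=
  (degree_sub_lt_left (degree_taylor q r) (by simpa using hq) (leadingCoeff_taylor r q)).trans_eq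
    (degree_taylor q r)

lemma degree_C_mul_le_of_le {R : Type*} [CommRing R] {p : R[X]} {d : WithBot ℕ} (a : R)
    (hp : p.degree ≤ d) : (C a * p).degree ≤ d :=
  (degree_mul_le_of_le degree_C_le hp).trans_eq (zero_add d)

lemma degree_sum_C_add_pow_mul_le {R : Type*} [CommRing R] {ι κ : Type*} {s : Finset ι}
    {t : Finset κ} {p : ι → R[X]} {q : κ → R[X]} {x : ι → R} {y : κ → R}
    (hp : ∀ e : ℕ, (∑ i ∈ s, C (x i ^ e) * p i).degree ≤ e)
    (hq : ∀ e : ℕ, (∑ j ∈ t, C (y j ^ e) * q j).degree ≤ e) (e : ℕ) :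
    (∑ k ∈ s ×ˢ t, C ((x k.1 + y k.2) ^ e) * (p k.1 * q k.2)).degree ≤ e := by
  have binomial : ∑ k ∈ s ×ˢ t, C ((x k.1 + y k.2) ^ e) * (p k.1 * q k.2) =
      ∑ c ∈ Finset.range (e + 1), C (e.choose c : R) *
        ((∑ i ∈ s, C (x i ^ c) * p i) * ∑ j ∈ t, C (y j ^ (e - c)) * q j) := by
    simp_rw [Finset.sum_mul_sum, ← Finset.sum_product', add_pow, Finset.mul_sum, map_sum,
      Finset.sum_mul]
    rw [Finset.sum_comm]
    refine Finset.sum_congr rfl fun c _ => Finset.sum_congr rfl fun k _ => ?_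
    simp only [C_mul]
    ring
  rw [binomial]
  refine (degree_sum_le _ _).trans (Finset.sup_le fun c hc => ?_)
  have hce : c + (e - c) = e := Nat.add_sub_cancel' (Finset.mem_range_succ_iff.mp hc)
  calc (C (e.choose c : R) * _).degree
      ≤ 0 + (c + (e - c : ℕ)) :=
        degree_mul_le_of_le degree_C_le (degree_mul_le_of_le (hp c) (hq (e - c)))
    _ = e := by rw [zero_add]; exact_mod_cast hce

/- Dividing `p k` by `X - x k` leaves the remainder `(p k).eval (x k)`; the coefficients of the
summed quotients are the coefficients of `X ^ m` in `∑ x k ^ e • p k` with `e < m`. -/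
lemma sum_eval_div_sub {K : Type*} [Field K] {ι : Type*} {s : Finset ι} {p : ι → K[X]} {x : ι → K}
    (hp : ∀ e : ℕ, (∑ k ∈ s, C (x k ^ e) * p k).degree ≤ e) {ν : K} (hν : ∀ k ∈ s, ν ≠ x k) :
    ∑ k ∈ s, (p k).eval ν / (ν - x k) = ∑ k ∈ s, (p k).eval (x k) / (ν - x k) := by
  obtain ⟨D, hD⟩ : ∃ D, ∀ k ∈ s, (p k).natDegree < D :=
    ⟨s.sup (fun k => (p k).natDegree) + 1, fun k hk =>
      Nat.lt_succ_of_le (Finset.le_sup (f := fun k => (p k).natDegree) hk)⟩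
  have quotient : ∀ k ∈ s, (p k).eval ν / (ν - x k) - (p k).eval (x k) / (ν - x k) =
      ∑ m ∈ Finset.range D, ∑ r ∈ Finset.range m,
        ν ^ r * (x k ^ (m - 1 - r) * (p k).coeff m) := by
    intro k hk
    rw [← sub_div, div_eq_iff (sub_ne_zero.mpr (hν k hk)), eval_eq_sum_range' (hD k hk),
      eval_eq_sum_range' (hD k hk), ← Finset.sum_sub_distrib, Finset.sum_mul]
    refine Finset.sum_congr rfl fun m _ => ?_
    rw [← mul_sub, ← geom_sum₂_mul, Finset.sum_mul, Finset.sum_mul, Finset.mul_sum]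
    exact Finset.sum_congr rfl fun r _ => by ring
  rw [← sub_eq_zero, ← Finset.sum_sub_distrib, Finset.sum_congr rfl quotient, Finset.sum_comm]
  refine Finset.sum_eq_zero fun m _ => ?_
  rw [Finset.sum_comm]
  refine Finset.sum_eq_zero fun r hr => ?_
  have hlt : m - 1 - r < m := by have := Finset.mem_range.mp hr; omega
  have hcoeff := coeff_eq_zero_of_degree_lt ((hp (m - 1 - r)).trans_lt (Nat.cast_lt.mpr hlt))
  simp only [finsetSum_coeff, coeff_C_mul] at hcoeff
  rw [← Finset.mul_sum, hcoeff, mul_zero]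

end PartialFractions

section TrigCoeff

open Polynomial

/-- The coefficients, as polynomials in `ν`, of the trigonometric sum
`∑ᵢ aᵢ(ν) sin ((ν + N - 2i) θ)` obtained from `sin (ν θ)` by applying the operators
`f ↦ 2 (sin · f' - (2n + 1) cos · f)` for `n = 0, …, N - 1`. In closed form
`aᵢ(ν) = (-1)ⁱ binom(N, i) (ν + N)(ν + N - 1)⋯(ν + N - i + 1) · (ν - i - 1)⋯(ν - N)`. -/
noncomputable def trigCoeff (N i : ℕ) : ℝ[X] :=
  C ((-1) ^ i * (N.choose i : ℝ)) * ((descPochhammer ℝ i).comp (X + C (N : ℝ)) *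
    (descPochhammer ℝ (N - i)).comp (X - C (i + 1 : ℝ)))

lemma eval_trigCoeff (N i : ℕ) (ν : ℝ) :
    (trigCoeff N i).eval ν = (-1) ^ i * N.choose i *
      ((descPochhammer ℝ i).eval (ν + N) * (descPochhammer ℝ (N - i)).eval (ν - (i + 1))) := by
  simp [trigCoeff]

lemma trigCoeff_eq_zero {N i : ℕ} (h : N < i) : trigCoeff N i = 0 := by
  simp [trigCoeff, Nat.choose_eq_zero_of_lt h]

lemma trigCoeff_zero_zero : trigCoeff 0 0 = 1 := by simp [trigCoeff]

lemma trigCoeff_succ_zero (N : ℕ) :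
    trigCoeff (N + 1) 0 = (X - C (N + 1 : ℝ)) * trigCoeff N 0 := by
  refine Polynomial.funext fun ν => ?_
  simp [eval_trigCoeff, descPochhammer_succ_eval]
  ring

lemma trigCoeff_succ_succ (N i : ℕ) :
    trigCoeff (N + 1) (i + 1) = (X - C (N + 1 + 2 * (i + 1 : ℕ) : ℝ)) * trigCoeff N (i + 1) -
      (X + C (3 * N + 1 - 2 * i : ℝ)) * trigCoeff N i := by
  refine Polynomial.funext fun ν => ?_
  rcases lt_trichotomy i N with h | rfl | h
  · obtain ⟨j, rfl⟩ : ∃ j, N = i + 1 + j := ⟨N - i - 1, by omega⟩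
    have hchoose := cast_choose_succ_mul (R := ℝ) (i + 1 + j) i
    simp only [eval_sub, eval_mul, eval_X, eval_C, eval_add, eval_trigCoeff,
      show i + 1 + j + 1 - (i + 1) = j + 1 by omega, show i + 1 + j - (i + 1) = j by omega,
      show i + 1 + j - i = j + 1 by omega, Nat.choose_succ_succ (i + 1 + j) i]
    push_cast at hchoose ⊢
    rw [descPochhammer_succ_eval_left i, descPochhammer_succ_eval i, descPochhammer_succ_eval j,
      descPochhammer_succ_eval_left j (ν - (i + 1)),
      show ν + (i + 1 + j + 1) - 1 = ν + (i + 1 + j : ℝ) by ring,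
      show ν - (i + 1 + 1) = ν - (i + 1 : ℝ) - 1 by ring]
    linear_combination (-1) ^ (i + 1) * (3 * ν + (i + 1 + j) - 1 - 2 * i) *
      (descPochhammer ℝ i).eval (ν + (i + 1 + j)) *
      (descPochhammer ℝ j).eval (ν - (i + 1) - 1) * hchoose
  · simp only [trigCoeff_eq_zero (Nat.lt_succ_self i), eval_sub, eval_mul, eval_X, eval_C, eval_add,
      eval_trigCoeff, Nat.choose_self, Nat.sub_self, descPochhammer_zero, eval_one,
      descPochhammer_succ_eval_left i, eval_zero, mul_zero]
    push_cast
    rw [show ν + ((i : ℝ) + 1) - 1 = ν + i by ring]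
    ring
  · rw [trigCoeff_eq_zero h, trigCoeff_eq_zero (Nat.succ_lt_succ h), trigCoeff_eq_zero (by omega)]
    simp

lemma sum_mul_trigCoeff_succ (N : ℕ) (F : ℕ → ℝ[X]) :
    ∑ i ∈ Finset.range (N + 2), F i * trigCoeff (N + 1) i =
      ∑ i ∈ Finset.range (N + 1), (F i * (X - C (N + 1 + 2 * i : ℝ)) -
        F (i + 1) * (X + C (3 * N + 1 - 2 * i : ℝ))) * trigCoeff N i := by
  have extend : ∑ i ∈ Finset.range (N + 1), F i * (X - C (N + 1 + 2 * i : ℝ)) * trigCoeff N i =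
      ∑ i ∈ Finset.range (N + 2), F i * (X - C (N + 1 + 2 * i : ℝ)) * trigCoeff N i := by
    rw [Finset.sum_range_succ _ (N + 1), trigCoeff_eq_zero (Nat.lt_succ_self N), mul_zero, add_zero]
  simp_rw [sub_mul (F _ * _)]
  rw [Finset.sum_sub_distrib, extend, Finset.sum_range_succ' _ (N + 1),
    Finset.sum_range_succ' _ (N + 1), trigCoeff_succ_zero, add_sub_right_comm,
    ← Finset.sum_sub_distrib]
  congr 1
  · exact Finset.sum_congr rfl fun i _ => by rw [trigCoeff_succ_succ]; ring
  · simp [mul_assoc]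

/- The two terms of the recursion for `trigCoeff` cancel to leading order in `ν`, so a step in `N`
trades a factor `ν` for a finite difference of `q`. -/
lemma degree_sum_eval_mul_trigCoeff_le (N : ℕ) (q : ℝ[X]) :
    (∑ i ∈ Finset.range (N + 1), C (q.eval (i : ℝ)) * trigCoeff N i).degree ≤ q.degree := by
  induction N generalizing q with
  | zero =>
    rcases eq_or_ne q 0 with rfl | hq
    · simp
    · simpa [trigCoeff_zero_zero] using degree_C_le.trans (zero_le_degree_iff.mpr hq)
  | succ N ih =>
    rcases eq_or_ne q 0 with rfl | hq
    · simp
    set d := taylor 1 q - q with hd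
    have hX : ∀ {p : ℝ[X]}, p.degree ≤ d.degree → (X * p).degree ≤ q.degree := fun {p} hp => by
      rw [degree_mul, degree_X, add_comm]
      exact Nat.WithBot.add_one_le_of_lt (hp.trans_lt (degree_taylor_sub_lt hq 1))
    set r : ℝ[X] := C 2 * (X * d) - C (N + 1 : ℝ) * q - C (3 * N + 1 : ℝ) * taylor 1 q with hr
    have hr_degree : r.degree ≤ q.degree :=
      (degree_sub_le_of_le (degree_sub_le_of_le (degree_C_mul_le_of_le 2 (hX le_rfl))
        (degree_C_mul_le_of_le _ le_rfl)) (degree_C_mul_le_of_le _ (degree_taylor q 1).le)).trans_eq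
        (by rw [max_self, max_self])
    have key : ∑ i ∈ Finset.range (N + 2), C (q.eval (i : ℝ)) * trigCoeff (N + 1) i =
        ∑ i ∈ Finset.range (N + 1), C (r.eval (i : ℝ)) * trigCoeff N i -
          X * ∑ i ∈ Finset.range (N + 1), C (d.eval (i : ℝ)) * trigCoeff N i := by
      rw [sum_mul_trigCoeff_succ N fun i => C (q.eval (i : ℝ)), Finset.mul_sum,
        ← Finset.sum_sub_distrib]
      refine Finset.sum_congr rfl fun i _ => ?_
      simp only [hr, hd, eval_sub, eval_mul, eval_C, eval_X, taylor_eval, Nat.cast_succ]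
      simp only [C_sub, C_mul, C_add]
      ring
    rw [key]
    exact degree_sub_le_of_le ((ih r).trans hr_degree) (hX (ih d)) |>.trans_eq (max_self _)

lemma degree_sum_sub_pow_mul_trigCoeff_le (N : ℕ) (c : ℝ) (e : ℕ) :
    (∑ i ∈ Finset.range (N + 1), C (((i : ℝ) - c) ^ e) * trigCoeff N i).degree ≤ e := by
  have h := degree_sum_eval_mul_trigCoeff_le N ((X - C c) ^ e)
  rw [degree_pow, degree_X_sub_C, nsmul_one] at h
  simpa only [eval_pow, eval_sub, eval_X, eval_C] using h

lemma eval_trigCoeff_natCast_sub {N n i : ℕ} (hn : n ≤ 2 * N) (hi : i ≤ N) :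
    (trigCoeff N i).eval ((n : ℝ) - N) =
      (-1) ^ N * N.factorial * (n.choose i * (2 * N - n).choose (N - i)) := by
  have hsign : (-1 : ℝ) ^ i * (-1) ^ (N - i) = (-1) ^ N := by
    rw [← pow_add, Nat.add_sub_cancel' hi]
  have hfactorial : (N.choose i : ℝ) * i.factorial * (N - i).factorial = N.factorial := by
    exact_mod_cast Nat.choose_mul_factorial_mul_factorial hi
  rw [eval_trigCoeff, sub_add_cancel, show (n : ℝ) - N - (i + 1) = -(N + i - n) - 1 by ring,
    descPochhammer_eval_neg_sub_one,
    show (N + i - n : ℝ) + (N - i : ℕ) = (2 * N - n : ℕ) by push_cast [hi, hn]; ring,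
    descPochhammer_eval_eq_descFactorial, descPochhammer_eval_eq_descFactorial,
    Nat.descFactorial_eq_factorial_mul_choose, Nat.descFactorial_eq_factorial_mul_choose,
    ← hsign, ← hfactorial]
  push_cast
  ring

lemma eval_trigCoeff_add_sub_comm {N i j : ℕ} (hi : i ≤ N) (hj : j ≤ N) :
    (trigCoeff N j).eval ((i : ℝ) + j - N) = (trigCoeff N i).eval ((i : ℝ) + j - N) := by
  have hij : i + j ≤ 2 * N := by omega
  rw [← Nat.cast_add, eval_trigCoeff_natCast_sub hij hi, eval_trigCoeff_natCast_sub hij hj,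
    Nat.choose_symm_add, ← Nat.choose_symm (show N - i ≤ 2 * N - (i + j) by omega),
    show 2 * N - (i + j) - (N - i) = N - j by omega]

lemma eval_trigCoeff_natCast_sub_eq_zero {N n i : ℕ} (hn : n ≤ 2 * N) (hi : i ≤ N)
    (h : n < i ∨ i + N < n) : (trigCoeff N i).eval ((n : ℝ) - N) = 0 := by
  rw [eval_trigCoeff_natCast_sub hn hi]
  rcases h with h | h
  · simp [Nat.choose_eq_zero_of_lt h]
  · simp [Nat.choose_eq_zero_of_lt (show 2 * N - n < N - i by omega)]

/-- The sum of the squares of the coefficients `trigCoeff N i`. Up to a constant it is the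
polynomial `P_{N+1}` in the centred variable `ν = s - (N + 1)`. -/
noncomputable def trigNormSq (N : ℕ) : ℝ[X] :=
  ∑ i ∈ Finset.range (N + 1), trigCoeff N i ^ 2

lemma eval_trigNormSq (N : ℕ) (ν : ℝ) :
    (trigNormSq N).eval ν = ∑ i ∈ Finset.range (N + 1), (trigCoeff N i).eval ν ^ 2 := by
  simp only [trigNormSq, eval_finsetSum, eval_pow]

lemma sum_eval_trigCoeff_sq_div (N i : ℕ) (hi : i ≤ N) (ν : ℝ) :
    ∑ j ∈ Finset.range (N + 1), (trigCoeff N i).eval ((i : ℝ) + j - N) ^ 2 /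
        (ν - ((i : ℝ) + j - N)) =
      ∑ n ∈ Finset.range (2 * N + 1), (trigCoeff N i).eval ((n : ℝ) - N) ^ 2 /
        (ν - ((n : ℝ) - N)) := by
  have shift := Finset.sum_Ico_eq_sum_range
    (fun n : ℕ => (trigCoeff N i).eval ((n : ℝ) - N) ^ 2 / (ν - ((n : ℝ) - N))) i (i + (N + 1))
  simp only [Nat.add_sub_cancel_left, Nat.cast_add] at shift
  rw [← shift]
  refine Finset.sum_subset (fun n hn => ?_) fun n hn hni => ?_
  · rw [Finset.mem_Ico] at hn
    rw [Finset.mem_range]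
    omega
  · rw [Finset.mem_range] at hn
    rw [Finset.mem_Ico] at hni
    rw [eval_trigCoeff_natCast_sub_eq_zero (by omega) hi (by omega)]
    simp

theorem sum_trigCoeff_mul_div_eq_sum_trigNormSq_div (N : ℕ) {ν : ℝ} (hν : ∀ m : ℤ, ν ≠ m) :
    ∑ i ∈ Finset.range (N + 1), ∑ j ∈ Finset.range (N + 1),
      (trigCoeff N i).eval ν * (trigCoeff N j).eval ν / (ν - ((i : ℝ) + j - N)) =
    ∑ n ∈ Finset.range (2 * N + 1), (trigNormSq N).eval ((n : ℝ) - N) / (ν - ((n : ℝ) - N)) := by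
  have moments := degree_sum_C_add_pow_mul_le (degree_sum_sub_pow_mul_trigCoeff_le N (N / 2))
    (degree_sum_sub_pow_mul_trigCoeff_le N (N / 2))
  have node : ∀ i j : ℕ, (i : ℝ) - N / 2 + (j - N / 2) = i + j - N := fun i j => by ring
  simp only [node] at moments
  have fractions := sum_eval_div_sub moments (ν := ν)
    fun k _ => by exact_mod_cast hν (k.1 + k.2 - N)
  simp only [eval_mul, Finset.sum_product] at fractions
  rw [fractions]
  simp_rw [eval_trigNormSq, Finset.sum_div]
  rw [Finset.sum_comm (s := Finset.range (2 * N + 1))]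
  refine Finset.sum_congr rfl fun i hi => ?_
  have hiN := Finset.mem_range_succ_iff.mp hi
  rw [← sum_eval_trigCoeff_sq_div N i hiN]
  refine Finset.sum_congr rfl fun j hj => ?_
  rw [eval_trigCoeff_add_sub_comm hiN (Finset.mem_range_succ_iff.mp hj), sq]

end TrigCoeff

section DifferenceEquation

open Polynomial

/-- The second-order difference operator of continuous dual Hahn type which annihilates both
`trigNormSq N` and `contactPoly N`. -/
noncomputable def wilsonOp (N : ℕ) : ℝ[X] →ₗ[ℝ] ℝ[X] :=
  LinearMap.mulLeft ℝ ((C (N + 1 : ℝ) + X) * (X - C (N : ℝ)) ^ 2) ∘ₗ (taylor 1 - LinearMap.id) -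
    LinearMap.mulLeft ℝ ((C (N + 1 : ℝ) - X) * (X + C (N : ℝ)) ^ 2) ∘ₗ
      (taylor (-1) - LinearMap.id) -
    LinearMap.mulLeft ℝ (C (2 * N : ℝ) * X)

lemma eval_wilsonOp (N : ℕ) (y : ℝ[X]) (ν : ℝ) :
    (wilsonOp N y).eval ν =
      (N + 1 + ν) * (ν - N) ^ 2 * (y.eval (ν + 1) - y.eval ν) -
        (N + 1 - ν) * (ν + N) ^ 2 * (y.eval (ν - 1) - y.eval ν) - 2 * N * ν * y.eval ν := by
  simp only [wilsonOp, LinearMap.sub_apply, LinearMap.comp_apply, LinearMap.mulLeft_apply,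
    LinearMap.id_apply, eval_sub, eval_mul, eval_add, eval_pow, eval_C, eval_X, taylor_eval]
  ring_nf

lemma eval_eq_zero_of_wilsonOp_eq_zero {N : ℕ} {y : ℝ[X]} (hy : wilsonOp N y = 0)
    (h₀ : y.eval ((N : ℝ) + 1) = 0) (j : ℕ) : y.eval ((N : ℝ) + 1 + j) = 0 := by
  have recursion (j : ℕ) (hj : y.eval ((N : ℝ) + 1 + j) = 0)
      (hprev : (j : ℝ) * y.eval ((N : ℝ) + 1 + j - 1) = 0) :
      y.eval ((N : ℝ) + 1 + j + 1) = 0 := by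
    have h := eval_wilsonOp N y (N + 1 + j)
    rw [hy, eval_zero, hj] at h
    have hne : ((N : ℝ) + 1 + (N + 1 + j)) * (1 + j) ^ 2 ≠ 0 := by positivity
    refine (mul_eq_zero.mp ?_).resolve_left hne
    linear_combination -h - (2 * N + 1 + j : ℝ) ^ 2 * hprev
  suffices h : ∀ j : ℕ, y.eval ((N : ℝ) + 1 + j) = 0 ∧ y.eval ((N : ℝ) + 1 + j + 1) = 0 from
    (h j).1
  intro j
  induction j with
  | zero => exact ⟨by simpa using h₀, recursion 0 (by simpa using h₀) (by simp)⟩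
  | succ j ih =>
    have hj : y.eval ((N : ℝ) + 1 + (j + 1 : ℕ)) = 0 := by
      rw [Nat.cast_succ, ← add_assoc]
      exact ih.2
    refine ⟨hj, recursion (j + 1) hj ?_⟩
    rw [Nat.cast_succ, ← add_assoc, add_sub_cancel_right, ih.1, mul_zero]

lemma eq_of_wilsonOp_eq_zero {N : ℕ} {y₁ y₂ : ℝ[X]} (h₁ : wilsonOp N y₁ = 0)
    (h₂ : wilsonOp N y₂ = 0) (h₀ : y₁.eval ((N : ℝ) + 1) = y₂.eval ((N : ℝ) + 1)) : y₁ = y₂ := by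
  have hsub : wilsonOp N (y₁ - y₂) = 0 := by rw [map_sub, h₁, h₂, sub_zero]
  refine sub_eq_zero.mp (eq_zero_of_infinite_isRoot _ ?_)
  refine Set.Infinite.mono (s := Set.range fun j : ℕ => (N : ℝ) + 1 + j) ?_
    (Set.infinite_range_of_injective fun a b hab => by simpa using hab)
  rintro _ ⟨j, rfl⟩
  exact eval_eq_zero_of_wilsonOp_eq_zero hsub (by rw [eval_sub, h₀, sub_self]) j

lemma eval_trigCoeff_add_one {N i : ℕ} (hi : i ≤ N) (ν : ℝ) :
    (trigCoeff N i).eval (ν + 1) * (ν + N + 1 - i) * (ν - N) =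
      (trigCoeff N i).eval ν * (ν + N + 1) * (ν - i) := by
  have upper := mul_descPochhammer_eval_sub_one i (ν + N + 1)
  have lower := mul_descPochhammer_eval_sub_one (N - i) (ν - i)
  rw [show ν + N + 1 - 1 = ν + N by ring] at upper
  rw [Nat.cast_sub hi, show ν - i - ((N : ℝ) - i) = ν - N by ring, sub_sub] at lower
  rw [eval_trigCoeff, eval_trigCoeff, show ν + 1 + N = ν + N + 1 by ring,
    show ν + 1 - (i + 1) = ν - (i : ℝ) by ring]
  linear_combination (-1) ^ i * (N.choose i : ℝ) *
    (-((descPochhammer ℝ (N - i)).eval (ν - i) * (ν - N)) * upper -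
      (ν + N + 1) * (descPochhammer ℝ i).eval (ν + N) * lower)

lemma eval_trigCoeff_succ_index {N i : ℕ} (hi : i ≤ N) (ν : ℝ) :
    (trigCoeff N (i + 1)).eval ν * ((i + 1) * (ν - i - 1)) =
      -((trigCoeff N i).eval ν * ((N - i) * (ν + N - i))) := by
  rcases hi.lt_or_eq with h | rfl
  · obtain ⟨j, rfl⟩ : ∃ j, N = i + 1 + j := ⟨N - i - 1, by omega⟩
    have hchoose := cast_choose_succ_mul (R := ℝ) (i + 1 + j) i
    rw [eval_trigCoeff, eval_trigCoeff, show i + 1 + j - (i + 1) = j by omega,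
      show i + 1 + j - i = j + 1 by omega, descPochhammer_succ_eval i,
      descPochhammer_succ_eval_left j (ν - (i + 1)), Nat.cast_succ i,
      show ν - ((i : ℝ) + 1 + 1) = ν - (i + 1) - 1 by ring, pow_succ]
    linear_combination -(-1) ^ i * (descPochhammer ℝ i).eval (ν + ((i + 1 + j : ℕ) : ℝ)) *
      (ν + ((i + 1 + j : ℕ) : ℝ) - i) * (descPochhammer ℝ j).eval (ν - (i + 1) - 1) *
      (ν - i - 1) * hchoose
  · rw [trigCoeff_eq_zero (Nat.lt_succ_self i)]
    simp

/-- The creative-telescoping certificate for `trigNormSq`: the difference operator applied to the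
`i`-th square is the increment of `wilsonCert` in `i`. -/
noncomputable def wilsonCert (N i : ℕ) (ν : ℝ) : ℝ :=
  ((trigCoeff N i).eval ν * i / (ν + N + 1 - i)) ^ 2 *
    ((N + 1) * ((2 * ν - (N + 1)) * (ν + N + 1) - 2 * ν * i))

lemma wilsonCert_succ {N i : ℕ} (hi : i ≤ N) {ν : ℝ} (hν : (N : ℝ) + 1 < ν) :
    wilsonCert N (i + 1) ν = ((trigCoeff N i).eval ν * (N - i) / (ν - 1 - i)) ^ 2 *
      ((N + 1) * ((2 * ν - (N + 1)) * (ν + N + 1) - 2 * ν * (i + 1))) := by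
  have hiN : (i : ℝ) ≤ N := by exact_mod_cast hi
  have hlower : ν - 1 - i ≠ 0 := by linarith
  have hupper : ν + N - i ≠ 0 := by linarith
  have ratio : (trigCoeff N (i + 1)).eval ν * (i + 1) / (ν + N - i) =
      -((trigCoeff N i).eval ν * (N - i) / (ν - 1 - i)) := by
    rw [← neg_div, div_eq_div_iff hupper hlower]
    linear_combination eval_trigCoeff_succ_index hi ν
  rw [wilsonCert, Nat.cast_succ, show ν + N + 1 - ((i : ℝ) + 1) = ν + N - i by ring, ratio, neg_sq]

lemma eval_wilsonOp_trigCoeff_sq {N i : ℕ} (hi : i ≤ N) {ν : ℝ} (hν : (N : ℝ) + 1 < ν) :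
    (wilsonOp N (trigCoeff N i ^ 2)).eval ν = wilsonCert N (i + 1) ν - wilsonCert N i ν := by
  have hiN : (i : ℝ) ≤ N := by exact_mod_cast hi
  have h₁ : ν + N + 1 - i ≠ 0 := by linarith
  have h₂ : ν - N ≠ 0 := by linarith
  have h₃ : ν + N ≠ 0 := by linarith [N.cast_nonneg (α := ℝ)]
  have h₄ : ν - 1 - i ≠ 0 := by linarith
  have right : (trigCoeff N i).eval (ν + 1) =
      (trigCoeff N i).eval ν * (ν + N + 1) * (ν - i) / ((ν + N + 1 - i) * (ν - N)) := by
    rw [eq_div_iff (mul_ne_zero h₁ h₂), ← eval_trigCoeff_add_one hi, mul_assoc]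
  have left : (trigCoeff N i).eval (ν - 1) =
      (trigCoeff N i).eval ν * (ν + N - i) * (ν - 1 - N) / ((ν + N) * (ν - 1 - i)) := by
    have shift := eval_trigCoeff_add_one hi (ν - 1)
    rw [sub_add_cancel] at shift
    rw [eq_div_iff (mul_ne_zero h₃ h₄)]
    linear_combination -shift
  rw [eval_wilsonOp, eval_pow, eval_pow, eval_pow, wilsonCert_succ hi hν, right, left, wilsonCert]
  field_simp
  ring

theorem wilsonOp_trigNormSq (N : ℕ) : wilsonOp N (trigNormSq N) = 0 := by
  refine eq_zero_of_infinite_isRoot _ ((Set.Ioi_infinite ((N : ℝ) + 1)).mono fun ν hν => ?_)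
  have telescope : ∑ i ∈ Finset.range (N + 1), (wilsonOp N (trigCoeff N i ^ 2)).eval ν =
      wilsonCert N (N + 1) ν - wilsonCert N 0 ν := by
    rw [← Finset.sum_range_sub (wilsonCert N · ν)]
    exact Finset.sum_congr rfl fun i hi =>
      eval_wilsonOp_trigCoeff_sq (Finset.mem_range_succ_iff.mp hi) hν
  rw [Set.mem_ofPred_eq, IsRoot, trigNormSq, map_sum, eval_finsetSum, telescope]
  simp [wilsonCert, trigCoeff_eq_zero (Nat.lt_succ_self N)]

lemma sum_range_sq_choose_two_mul_add_one (N : ℕ) :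
    2 * ∑ i ∈ Finset.range (N + 1), (2 * N + 1).choose i ^ 2 =
      (2 * (2 * N + 1)).choose (2 * N + 1) := by
  have upper : ∑ i ∈ Finset.range (N + 1), (2 * N + 1).choose (N + 1 + i) ^ 2 =
      ∑ i ∈ Finset.range (N + 1), (2 * N + 1).choose i ^ 2 := by
    rw [← Finset.sum_range_reflect (fun i => (2 * N + 1).choose i ^ 2)]
    refine Finset.sum_congr rfl fun i hi => ?_
    have hi' := Finset.mem_range.mp hi
    rw [← Nat.choose_symm (show N + 1 + i ≤ 2 * N + 1 by omega)]
    congr 2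
    omega
  rw [← Nat.sum_range_choose_sq (2 * N + 1), show 2 * N + 1 + 1 = (N + 1) + (N + 1) by ring,
    Finset.sum_range_add _ (N + 1), upper, two_mul]

lemma eval_trigNormSq_add_one (N : ℕ) :
    (trigNormSq N).eval ((N : ℝ) + 1) =
      (N.factorial : ℝ) ^ 2 * (2 * (2 * N + 1)).choose (2 * N + 1) / 2 := by
  have coeff_sq (i : ℕ) (hi : i ∈ Finset.range (N + 1)) :
      (trigCoeff N i).eval ((N : ℝ) + 1) ^ 2 =
        (N.factorial : ℝ) ^ 2 * ((2 * N + 1).choose i : ℝ) ^ 2 := by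
    have hiN := Finset.mem_range_succ_iff.mp hi
    have hfactorial : (N.choose i : ℝ) * i.factorial * (N - i).factorial = N.factorial := by
      exact_mod_cast Nat.choose_mul_factorial_mul_factorial hiN
    rw [eval_trigCoeff, show (N : ℝ) + 1 + N = (2 * N + 1 : ℕ) by push_cast; ring,
      show (N : ℝ) + 1 - (i + 1) = (N - i : ℕ) by push_cast [hiN]; ring,
      descPochhammer_eval_eq_descFactorial, descPochhammer_eval_eq_descFactorial,
      Nat.descFactorial_self, Nat.descFactorial_eq_factorial_mul_choose, ← hfactorial, mul_assoc,
      mul_pow, ← pow_mul, mul_comm i 2, pow_mul, neg_one_sq, one_pow]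
    push_cast
    ring
  rw [eval_trigNormSq, Finset.sum_congr rfl coeff_sq, ← Finset.mul_sum,
    ← sum_range_sq_choose_two_mul_add_one]
  push_cast
  ring

/-- The coefficients of `P_{N+1}` in the basis `wilsonBasis N`. -/
noncomputable def contactPolyCoeff (N n : ℕ) : ℝ :=
  2 * ((-1) ^ n * ((2 * n).factorial * N.factorial ^ 4 * (N + n).factorial /
    (n.factorial ^ 4 * (N - n).factorial * (2 * (N + n) + 1).factorial)))

lemma contactPolyCoeff_succ {N n : ℕ} (hn : n < N) :
    contactPolyCoeff N (n + 1) * ((n + 1) ^ 3 * (2 * N + 2 * n + 3)) =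
      contactPolyCoeff N n * ((2 * n + 1) * (n - N)) := by
  obtain ⟨j, rfl⟩ : ∃ j, N = n + 1 + j := ⟨N - n - 1, by omega⟩
  simp only [contactPolyCoeff]
  rw [show n + 1 + j - (n + 1) = j by omega, show n + 1 + j - n = j + 1 by omega,
    show n + 1 + j + (n + 1) = n + 1 + j + n + 1 by ring]
  simp only [Nat.mul_add_one, Nat.factorial_succ, Nat.add_succ, pow_succ (-1 : ℝ)]
  push_cast
  field_simp
  ring

/-- The polynomial `(N + 1 - ν)ₙ (N + 1 + ν)ₙ` in `ν`, written as a product. -/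
noncomputable def wilsonBasis (N n : ℕ) : ℝ[X] :=
  ∏ k ∈ Finset.range n, (C ((N + 1 + k : ℝ) ^ 2) - X ^ 2)

lemma eval_wilsonBasis_succ (N n : ℕ) (ν : ℝ) :
    (wilsonBasis N (n + 1)).eval ν = (wilsonBasis N n).eval ν * ((N + 1 + n) ^ 2 - ν ^ 2) := by
  simp [wilsonBasis, Finset.prod_range_succ]

lemma eval_neg_wilsonBasis (N n : ℕ) (ν : ℝ) :
    (wilsonBasis N n).eval (-ν) = (wilsonBasis N n).eval ν := by
  simp [wilsonBasis, eval_prod]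

lemma eval_wilsonBasis_add_one (N n : ℕ) (ν : ℝ) :
    (wilsonBasis N (n + 1)).eval (ν + 1) * (N + 1 + ν) =
      (wilsonBasis N n).eval ν * (N - ν) * ((N + 1 + ν + n) * (N + 1 + ν + n + 1)) := by
  induction n with
  | zero =>
    simp [wilsonBasis]
    ring
  | succ n ih =>
    rw [eval_wilsonBasis_succ N (n + 1), eval_wilsonBasis_succ N n ν, Nat.cast_succ]
    linear_combination ((N + 1 + (n + 1)) ^ 2 - (ν + 1) ^ 2) * ih

lemma eval_wilsonBasis_sub_one (N n : ℕ) (ν : ℝ) :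
    (wilsonBasis N (n + 1)).eval (ν - 1) * (N + 1 - ν) =
      (wilsonBasis N n).eval ν * (N + ν) * ((N + 1 - ν + n) * (N + 1 - ν + n + 1)) := by
  have h := eval_wilsonBasis_add_one N n (-ν)
  rwa [show -ν + 1 = -(ν - 1) by ring, eval_neg_wilsonBasis, eval_neg_wilsonBasis,
    ← sub_eq_add_neg, sub_neg_eq_add] at h

lemma eval_wilsonOp_wilsonBasis_succ (N n : ℕ) (ν : ℝ) :
    (wilsonOp N (wilsonBasis N (n + 1))).eval ν =
      ν * (2 * (2 * n + 3) * (n + 1 - N) * (wilsonBasis N (n + 1)).eval ν -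
        2 * (n + 1) ^ 3 * (2 * N + 2 * n + 3) * (wilsonBasis N n).eval ν) := by
  rw [eval_wilsonOp, eval_wilsonBasis_succ N n ν]
  linear_combination (ν - N) ^ 2 * eval_wilsonBasis_add_one N n ν -
    (ν + N) ^ 2 * eval_wilsonBasis_sub_one N n ν

/-- The polynomial `P_{N+1}` in the centred variable `ν = s - (N + 1)`. -/
noncomputable def contactPoly (N : ℕ) : ℝ[X] :=
  ∑ n ∈ Finset.range (N + 1), C (contactPolyCoeff N n) * wilsonBasis N n

theorem wilsonOp_contactPoly (N : ℕ) : wilsonOp N (contactPoly N) = 0 := by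
  refine Polynomial.funext fun ν => ?_
  have partial_sum : ∀ k ≤ N, ∑ n ∈ Finset.range (k + 1),
      contactPolyCoeff N n * (wilsonOp N (wilsonBasis N n)).eval ν =
        2 * ν * contactPolyCoeff N k * ((2 * k + 1) * (k - N)) * (wilsonBasis N k).eval ν := by
    intro k
    induction k with
    | zero =>
      intro _
      simp [eval_wilsonOp, wilsonBasis]
      ring
    | succ k ih =>
      intro hk
      rw [Finset.sum_range_succ, ih (by omega), eval_wilsonOp_wilsonBasis_succ, Nat.cast_succ]
      linear_combination (-2 * ν * (wilsonBasis N k).eval ν) * contactPolyCoeff_succ hk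
  simp_rw [contactPoly, map_sum, C_mul', map_smul, eval_finsetSum, eval_smul, smul_eq_mul]
  rw [partial_sum N le_rfl, sub_self]
  simp

lemma eval_contactPoly_add_one (N : ℕ) :
    (contactPoly N).eval ((N : ℝ) + 1) = 2 * N.factorial ^ 3 * N.factorial /
      (2 * N + 1).factorial := by
  have vanish (n : ℕ) : (wilsonBasis N (n + 1)).eval ((N : ℝ) + 1) = 0 := by
    simp [wilsonBasis, Finset.prod_range_succ']
  rw [contactPoly, eval_finsetSum, Finset.sum_range_succ', Finset.sum_eq_zero, zero_add]
  · simp [contactPolyCoeff, wilsonBasis]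
    field_simp
  · intro n _
    rw [eval_mul, vanish, mul_zero]

theorem contactPoly_eq_C_mul_trigNormSq (N : ℕ) :
    contactPoly N = C (4 * N.factorial ^ 2 /
      ((2 * N + 1).factorial * (2 * (2 * N + 1)).choose (2 * N + 1)) : ℝ) * trigNormSq N := by
  refine eq_of_wilsonOp_eq_zero (wilsonOp_contactPoly N) ?_ ?_
  · rw [C_mul', map_smul, wilsonOp_trigNormSq, smul_zero]
  · have hchoose : ((2 * (2 * N + 1)).choose (2 * N + 1) : ℝ) ≠ 0 := by
      exact_mod_cast (Nat.choose_pos (by omega)).ne'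
    rw [eval_mul, eval_C, eval_contactPoly_add_one, eval_trigNormSq_add_one]
    field_simp
    ring

end DifferenceEquation

section GammaIntegral

open ProbabilityTheory

lemma integrableOn_rpow_mul_exp_neg_mul {a r : ℝ} (ha : 0 < a) (hr : 0 < r) :
    IntegrableOn (fun t : ℝ => t ^ (a - 1) * Real.exp (-(r * t))) (Set.Ioi 0) := by
  have h := integrableOn_rpow_mul_exp_neg_mul_rpow (s := a - 1) (p := 1) (by linarith) one_pos hr
  simpa only [Real.rpow_one, neg_mul] using h

/-- The measure `t ^ (a - 1) dt` on the positive half-line, whose moment generating function at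
`-r` is the Gamma integral with rate `r`. -/
noncomputable def rpowMeasure (a : ℝ) : Measure ℝ :=
  (volume.restrict (Set.Ioi 0)).withDensity fun t => ENNReal.ofReal (t ^ (a - 1))

lemma integral_rpowMeasure {E : Type*} [NormedAddCommGroup E] [NormedSpace ℝ E] (a : ℝ)
    (f : ℝ → E) :
    ∫ t, f t ∂rpowMeasure a = ∫ t in Set.Ioi (0 : ℝ), t ^ (a - 1) • f t := by
  rw [rpowMeasure, integral_withDensity_eq_integral_toReal_smul (by fun_prop)
    (Eventually.of_forall fun _ => ENNReal.ofReal_lt_top)]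
  refine setIntegral_congr_fun measurableSet_Ioi fun t ht => ?_
  simp only [ENNReal.toReal_ofReal (Real.rpow_nonneg (Set.mem_Ioi.mp ht).le _)]

lemma Iio_zero_subset_integrableExpSet_rpowMeasure {a : ℝ} (ha : 0 < a) :
    Set.Iio 0 ⊆ integrableExpSet id (rpowMeasure a) := by
  intro r hr
  refine (integrable_withDensity_iff_integrable_smul' (by fun_prop)
    (Eventually.of_forall fun _ => ENNReal.ofReal_lt_top)).mpr ?_
  refine (integrableOn_rpow_mul_exp_neg_mul ha (neg_pos.mpr hr)).congr_fun
    (fun t ht => ?_) measurableSet_Ioi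
  simp [ENNReal.toReal_ofReal (Real.rpow_nonneg (Set.mem_Ioi.mp ht).le _)]

lemma integral_rpow_mul_cexp_neg_mul_Ioi {a : ℝ} {r : ℂ} (ha : 0 < a) (hr : 0 < r.re) :
    ∫ t in Set.Ioi (0 : ℝ), ((t ^ (a - 1) : ℝ) : ℂ) * Complex.exp (-(r * t)) =
      r ^ (-a : ℂ) * Complex.Gamma a := by
  have hmgf (w : ℂ) : ∫ t in Set.Ioi (0 : ℝ), ((t ^ (a - 1) : ℝ) : ℂ) * Complex.exp (-(w * t)) =
      complexMGF id (rpowMeasure a) (-w) := by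
    simp [complexMGF, integral_rpowMeasure]
  have hopen : IsOpen {w : ℂ | 0 < w.re} := isOpen_lt continuous_const Complex.continuous_re
  have hF : AnalyticOnNhd ℂ (fun w => complexMGF id (rpowMeasure a) (-w)) {w | 0 < w.re} := by
    refine DifferentiableOn.analyticOnNhd (differentiableOn_complexMGF.comp
      differentiable_neg.differentiableOn fun w hw => ?_) hopen
    exact interior_maximal (Iio_zero_subset_integrableExpSet_rpowMeasure ha) isOpen_Iio
      (by simpa using hw)
  have hG : AnalyticOnNhd ℂ (fun w => w ^ (-a : ℂ) * Complex.Gamma a) {w | 0 < w.re} :=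
    DifferentiableOn.analyticOnNhd (fun w hw => ((differentiableAt_id.cpow_const
      (Or.inl hw)).mul_const _).differentiableWithinAt) hopen
  have hreal : ∃ᶠ w in 𝓝[≠] (1 : ℂ), complexMGF id (rpowMeasure a) (-w) =
      w ^ (-a : ℂ) * Complex.Gamma a := by
    have htend : Tendsto (fun x : ℝ => (x : ℂ)) (𝓝[≠] 1) (𝓝[≠] (1 : ℂ)) :=
      Complex.continuous_ofReal.continuousAt.continuousWithinAt.tendsto_nhdsWithin
        fun x hx => by simpa using hx
    refine htend.frequently (Eventually.frequently ?_)
    filter_upwards [nhdsWithin_le_nhds (lt_mem_nhds one_pos)] with x hx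
    have h := Complex.integral_cpow_mul_exp_neg_mul_Ioi (a := a) (by simpa using ha) hx
    rw [one_div, Complex.inv_cpow_ofReal_nonneg hx.le, ← Complex.cpow_neg] at h
    rw [← hmgf, ← h]
    refine setIntegral_congr_fun measurableSet_Ioi fun t ht => ?_
    simp [Complex.ofReal_cpow (Set.mem_Ioi.mp ht).le]
  rw [hmgf]
  exact hF.eqOn_of_preconnected_of_frequently_eq hG
    (convex_halfSpace_re_gt 0).isPreconnected (by simp) hreal hr

end GammaIntegral

section PoleIntegral

lemma integrable_rpow_mul_cexp_add_mul {a b : ℂ} {ν : ℝ} (ha : 0 < a.re) (hb : 0 < b.re)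
    (h0 : 0 < ν) (h1 : ν < 1) :
    Integrable (fun p : ℝ × ℝ => ((p.1 ^ (-ν) : ℝ) : ℂ) * Complex.exp (-((a + b * p.1) * p.2)))
      ((volume.restrict (Set.Ioi 0)).prod (volume.restrict (Set.Ioi 0))) := by
  have hnorm {τ : ℝ} (hτ : 0 < τ) (y : ℝ) :
      ‖((τ ^ (-ν) : ℝ) : ℂ) * Complex.exp (-((a + b * τ) * y))‖ =
        Real.exp (-(a.re * y)) * (τ ^ (1 - ν - 1) * Real.exp (-(b.re * y * τ))) := by
    rw [norm_mul, Complex.norm_real, Real.norm_of_nonneg (by positivity), Complex.norm_exp,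
      mul_left_comm, ← Real.exp_add, sub_sub_cancel_left]
    congr 2
    simp
    ring
  rw [integrable_prod_iff' (Measurable.aestronglyMeasurable (by fun_prop))]
  refine ⟨?_, ?_⟩
  · filter_upwards [ae_restrict_mem measurableSet_Ioi] with y hy
    refine (integrable_norm_iff (Measurable.aestronglyMeasurable (by fun_prop))).mp ?_
    exact IntegrableOn.congr_fun ((integrableOn_rpow_mul_exp_neg_mul (by linarith)
      (mul_pos hb hy)).const_mul _) (fun τ hτ => (hnorm hτ y).symm) measurableSet_Ioi
  · refine IntegrableOn.congr_fun ((integrableOn_rpow_mul_exp_neg_mul h0 ha).const_mul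
      ((1 / b.re) ^ (1 - ν) * Real.Gamma (1 - ν))) (fun y hy => ?_) measurableSet_Ioi
    have hy0 : 0 < y := hy
    simp only
    rw [setIntegral_congr_fun measurableSet_Ioi fun τ hτ => hnorm hτ y, integral_const_mul,
      Real.integral_rpow_mul_exp_neg_mul_Ioi (by linarith) (by positivity), ← div_div,
      div_eq_mul_inv _ y, Real.mul_rpow (by positivity) (by positivity), Real.inv_rpow hy0.le,
      ← Real.rpow_neg hy0.le, neg_sub]
    ring

lemma ofReal_mul_cpow {y : ℝ} {b : ℂ} (hy : 0 < y) (hb : b ≠ 0) (s : ℂ) :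
    (y * b : ℂ) ^ s = (y : ℂ) ^ s * b ^ s := by
  have hy' : (y : ℂ) ≠ 0 := Complex.ofReal_ne_zero.mpr hy.ne'
  rw [Complex.cpow_def_of_ne_zero (mul_ne_zero hy' hb), Complex.cpow_def_of_ne_zero hy',
    Complex.cpow_def_of_ne_zero hb, Complex.log_ofReal_mul hy hb, Complex.ofReal_log hy.le,
    add_mul, Complex.exp_add]

lemma integral_rpow_neg_div_add_mul {a b : ℂ} {ν : ℝ} (ha : 0 < a.re) (hb : 0 < b.re)
    (h0 : 0 < ν) (h1 : ν < 1) :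
    ∫ τ in Set.Ioi (0 : ℝ), ((τ ^ (-ν) : ℝ) : ℂ) / (a + b * τ) =
      Real.pi / Complex.sin (Real.pi * ν) * (a ^ (-ν : ℂ) * b ^ (ν - 1 : ℂ)) := by
  have hb0 : b ≠ 0 := fun h => by simp [h] at hb
  have hschwinger {τ : ℝ} (hτ : 0 < τ) : ((τ ^ (-ν) : ℝ) : ℂ) / (a + b * τ) =
      ∫ y in Set.Ioi (0 : ℝ), ((τ ^ (-ν) : ℝ) : ℂ) * Complex.exp (-((a + b * τ) * y)) := by
    have hre : (-(a + b * τ)).re < 0 := by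
      simpa using by linarith [mul_pos hb hτ]
    have h := integral_exp_mul_complex_Ioi hre 0
    simp only [Complex.ofReal_zero, mul_zero, Complex.exp_zero, neg_mul] at h
    rw [integral_const_mul, h, neg_div_neg_eq, div_eq_mul_one_div]
  have hinner {y : ℝ} (hy : 0 < y) :
      ∫ τ in Set.Ioi (0 : ℝ), ((τ ^ (-ν) : ℝ) : ℂ) * Complex.exp (-((a + b * τ) * y)) =
        b ^ (ν - 1 : ℂ) * Complex.Gamma (1 - ν) *
          (((y ^ (ν - 1) : ℝ) : ℂ) * Complex.exp (-(a * y))) := by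
    have h := integral_rpow_mul_cexp_neg_mul_Ioi (a := 1 - ν) (r := y * b) (by linarith)
      (by simpa using mul_pos hy hb)
    rw [ofReal_mul_cpow hy hb0] at h
    have hexp (τ : ℝ) : ((τ ^ (-ν) : ℝ) : ℂ) * Complex.exp (-((a + b * τ) * y)) =
        Complex.exp (-(a * y)) * (((τ ^ (-ν) : ℝ) : ℂ) * Complex.exp (-(y * b * τ))) := by
      rw [mul_left_comm, ← Complex.exp_add]
      ring_nf
    push_cast [sub_sub_cancel_left, neg_sub] at h
    simp only [hexp]
    rw [integral_const_mul, h]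
    push_cast [Complex.ofReal_cpow hy.le]
    ring
  rw [setIntegral_congr_fun measurableSet_Ioi fun τ hτ => hschwinger hτ,
    integral_integral_swap (integrable_rpow_mul_cexp_add_mul ha hb h0 h1),
    setIntegral_congr_fun measurableSet_Ioi fun y hy => hinner hy, integral_const_mul,
    integral_rpow_mul_cexp_neg_mul_Ioi h0 ha, ← Complex.Gamma_mul_Gamma_one_sub]
  ring

end PoleIntegral

section QuadMellin

lemma integrableOn_rpow_mul_one_add_rpow_neg {σ m : ℝ} (h0 : 0 < σ) (h1 : σ < m) :
    IntegrableOn (fun τ : ℝ => τ ^ (σ - 1) * (1 + τ) ^ (-m)) (Set.Ioi 0) := by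
  rw [← Set.Ioc_union_Ioi_eq_Ioi (zero_le_one' ℝ)]
  have hnorm {τ : ℝ} (hτ : 0 < τ) : ‖τ ^ (σ - 1) * (1 + τ) ^ (-m)‖ =
      τ ^ (σ - 1) * (1 + τ) ^ (-m) := Real.norm_of_nonneg (by positivity)
  refine IntegrableOn.union ?_ ?_
  · have hi : IntegrableOn (fun τ : ℝ => τ ^ (σ - 1)) (Set.Ioc 0 1) := by
      rw [← intervalIntegrable_iff_integrableOn_Ioc_of_le zero_le_one]
      exact intervalIntegral.intervalIntegrable_rpow' (by linarith)
    refine hi.mono' (Measurable.aestronglyMeasurable (by fun_prop)) ?_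
    filter_upwards [ae_restrict_mem measurableSet_Ioc] with τ hτ
    rw [hnorm hτ.1]
    exact mul_le_of_le_one_right (Real.rpow_nonneg hτ.1.le _)
      (Real.rpow_le_one_of_one_le_of_nonpos (by linarith [hτ.1]) (by linarith))
  · have hi : IntegrableOn (fun τ : ℝ => τ ^ (σ - 1 + -m)) (Set.Ioi 1) :=
      integrableOn_Ioi_rpow_of_lt (by linarith) one_pos
    refine hi.mono' (Measurable.aestronglyMeasurable (by fun_prop)) ?_
    filter_upwards [ae_restrict_mem measurableSet_Ioi] with τ hτ
    have hτ0 : 0 < τ := one_pos.trans hτ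
    rw [hnorm hτ0, Real.rpow_add hτ0]
    exact mul_le_mul_of_nonneg_left (Real.rpow_le_rpow_of_nonpos hτ0 (by linarith)
      (by linarith)) (by positivity)

lemma one_add_sq_mul_le {τ c θ : ℝ} (hc : c ≤ Real.cos θ) :
    (1 + c) / 2 * (1 + τ) ^ 2 ≤ 1 + 2 * τ * Real.cos θ + τ ^ 2 := by
  nlinarith [mul_nonneg (sub_nonneg.mpr (Real.cos_le_one θ)) (sq_nonneg (1 - τ)),
    mul_nonneg (sub_nonneg.mpr hc) (sq_nonneg (1 + τ))]

lemma one_add_two_mul_cos_add_sq_pos {τ θ : ℝ} (hτ : 0 ≤ τ) (hθ : -1 < Real.cos θ) :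
    0 < 1 + 2 * τ * Real.cos θ + τ ^ 2 := by
  have : 0 < 1 + Real.cos θ := by linarith
  exact lt_of_lt_of_le (by positivity) (one_add_sq_mul_le le_rfl)

/-- The Mellin transform at `σ` of `τ ↦ (1 + 2 τ cos θ + τ²) ^ (-Δ)`. -/
noncomputable def quadMellin (Δ σ θ : ℝ) : ℝ :=
  ∫ τ in Set.Ioi (0 : ℝ), τ ^ (σ - 1) * (1 + 2 * τ * Real.cos θ + τ ^ 2) ^ (-Δ)

lemma rpow_mul_quad_rpow_neg_le {Δ τ c θ : ℝ} (σ : ℝ) (hΔ : 0 ≤ Δ) (hτ : 0 < τ) (hc1 : -1 < c)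
    (hc : c ≤ Real.cos θ) :
    τ ^ (σ - 1) * (1 + 2 * τ * Real.cos θ + τ ^ 2) ^ (-Δ) ≤
      ((1 + c) / 2) ^ (-Δ) * (τ ^ (σ - 1) * (1 + τ) ^ (-(2 * Δ))) := by
  have h1 : 0 < (1 + c) / 2 := by linarith
  calc
    _ ≤ τ ^ (σ - 1) * ((1 + c) / 2 * (1 + τ) ^ 2) ^ (-Δ) := by
      gcongr ?_ * ?_
      exact Real.rpow_le_rpow_of_nonpos (by positivity) (one_add_sq_mul_le hc) (by linarith)
    _ = _ := by
      rw [Real.mul_rpow h1.le (by positivity), ← Real.rpow_natCast, ← Real.rpow_mul (by positivity),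
        Nat.cast_ofNat, mul_neg]
      ring

lemma integrableOn_quadMellin {Δ σ θ : ℝ} (h0 : 0 < σ) (h1 : σ < 2 * Δ) (hθ : -1 < Real.cos θ) :
    IntegrableOn (fun τ : ℝ => τ ^ (σ - 1) * (1 + 2 * τ * Real.cos θ + τ ^ 2) ^ (-Δ))
      (Set.Ioi 0) := by
  refine ((integrableOn_rpow_mul_one_add_rpow_neg h0 h1).const_mul
    (((1 + Real.cos θ) / 2) ^ (-Δ))).mono' (Measurable.aestronglyMeasurable (by fun_prop)) ?_
  filter_upwards [ae_restrict_mem measurableSet_Ioi] with τ hτ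
  have hτ0 : 0 < τ := hτ
  have hq := one_add_two_mul_cos_add_sq_pos hτ0.le hθ
  rw [Real.norm_of_nonneg (by positivity)]
  exact rpow_mul_quad_rpow_neg_le σ (by linarith) hτ0 hθ le_rfl

lemma hasDerivAt_rpow_mul_quad_rpow_neg {τ θ : ℝ} (Δ σ : ℝ) (hτ : 0 < τ) (hθ : -1 < Real.cos θ) :
    HasDerivAt (fun x => τ ^ (σ - 1) * (1 + 2 * τ * Real.cos x + τ ^ 2) ^ (-Δ))
      (2 * Δ * Real.sin θ *
        (τ ^ (σ + 1 - 1) * (1 + 2 * τ * Real.cos θ + τ ^ 2) ^ (-(Δ + 1)))) θ := by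
  have hq := one_add_two_mul_cos_add_sq_pos hτ.le hθ
  have hd : HasDerivAt (fun x => 1 + 2 * τ * Real.cos x + τ ^ 2) (2 * τ * -Real.sin θ) θ :=
    (((Real.hasDerivAt_cos θ).const_mul (2 * τ)).const_add 1).add_const _
  refine ((hd.rpow_const (p := -Δ) (Or.inl hq.ne')).const_mul (τ ^ (σ - 1))).congr_deriv ?_
  rw [show σ + 1 - 1 = σ - 1 + 1 by ring, Real.rpow_add_one hτ.ne', neg_add']
  ring

lemma norm_deriv_rpow_mul_quad_rpow_neg_le {Δ τ c θ : ℝ} (σ : ℝ) (hΔ : 0 ≤ Δ) (hτ : 0 < τ)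
    (hc1 : -1 < c) (hc : c ≤ Real.cos θ) :
    ‖2 * Δ * Real.sin θ * (τ ^ (σ - 1) * (1 + 2 * τ * Real.cos θ + τ ^ 2) ^ (-(Δ + 1)))‖ ≤
      2 * Δ * (((1 + c) / 2) ^ (-(Δ + 1)) * (τ ^ (σ - 1) * (1 + τ) ^ (-(2 * (Δ + 1))))) := by
  have hq := one_add_two_mul_cos_add_sq_pos hτ.le (hc1.trans_le hc)
  rw [norm_mul, norm_mul, Real.norm_of_nonneg (show 0 ≤ 2 * Δ by positivity),
    Real.norm_of_nonneg (show 0 ≤ τ ^ (σ - 1) * _ by positivity)]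
  exact mul_le_mul (mul_le_of_le_one_right (by positivity) (Real.abs_sin_le_one θ))
    (rpow_mul_quad_rpow_neg_le σ (by positivity) hτ hc1 hc) (by positivity) (by positivity)

lemma hasDerivAt_quadMellin {Δ σ θ : ℝ} (h0 : 0 < σ) (h1 : σ < 2 * Δ) (hθ : -1 < Real.cos θ) :
    HasDerivAt (quadMellin Δ σ) (2 * Δ * Real.sin θ * quadMellin (Δ + 1) (σ + 1) θ) θ := by
  obtain ⟨c, hc1, hc⟩ := exists_between hθ
  have hs : {x : ℝ | c < Real.cos x} ∈ 𝓝 θ :=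
    (isOpen_lt continuous_const Real.continuous_cos).mem_nhds hc
  have hbound := ((integrableOn_rpow_mul_one_add_rpow_neg (σ := σ + 1) (m := 2 * (Δ + 1))
    (by linarith) (by linarith)).const_mul (((1 + c) / 2) ^ (-(Δ + 1)))).const_mul (2 * Δ)
  have hderiv := hasDerivAt_integral_of_dominated_loc_of_deriv_le
    (μ := volume.restrict (Set.Ioi 0))
    (F := fun x τ => τ ^ (σ - 1) * (1 + 2 * τ * Real.cos x + τ ^ 2) ^ (-Δ))
    (F' := fun x τ => 2 * Δ * Real.sin x *
      (τ ^ (σ + 1 - 1) * (1 + 2 * τ * Real.cos x + τ ^ 2) ^ (-(Δ + 1))))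
    hs (Eventually.of_forall fun x => Measurable.aestronglyMeasurable (by fun_prop))
    (integrableOn_quadMellin h0 h1 hθ) (Measurable.aestronglyMeasurable (by fun_prop)) ?_ hbound ?_
  · rw [quadMellin, ← integral_const_mul]
    exact hderiv.2
  · filter_upwards [ae_restrict_mem measurableSet_Ioi] with τ hτ x hx
    exact norm_deriv_rpow_mul_quad_rpow_neg_le (σ + 1) (by linarith) hτ hc1 (le_of_lt hx)
  · filter_upwards [ae_restrict_mem measurableSet_Ioi] with τ hτ x hx
    exact hasDerivAt_rpow_mul_quad_rpow_neg Δ σ hτ (hc1.trans hx)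

lemma cexp_cpow {z : ℂ} (h1 : -Real.pi < z.im) (h2 : z.im ≤ Real.pi) (s : ℂ) :
    Complex.exp z ^ s = Complex.exp (z * s) := by
  rw [Complex.cpow_def_of_ne_zero (Complex.exp_ne_zero z), Complex.log_exp h1 h2]

lemma integral_rpow_neg_div_cexp_neg_add {ν θ : ℝ} (h0 : 0 < ν) (h1 : ν < 1)
    (hθ : |θ| < Real.pi) :
    ∫ τ in Set.Ioi (0 : ℝ), ((τ ^ (-ν) : ℝ) : ℂ) / (Complex.exp (-(θ * Complex.I)) + τ) =
      Real.pi / Complex.sin (Real.pi * ν) * Complex.exp (ν * θ * Complex.I) := by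
  obtain ⟨hθ1, hθ2⟩ := abs_lt.mp hθ
  -- The pole at angle `θ ± π` is balanced between two rays of angle `∓ θ / 2`, which keeps both
  -- Gamma integrals convergent for all `|θ| < π`.
  have hcos : 0 < Real.cos (θ / 2) :=
    Real.cos_pos_of_mem_Ioo ⟨by linarith, by linarith⟩
  have him : (θ / 2 * Complex.I : ℂ).im = θ / 2 := by simp
  have hrot (τ : ℝ) : ((τ ^ (-ν) : ℝ) : ℂ) / (Complex.exp (-(θ * Complex.I)) + τ) =
      Complex.exp (θ / 2 * Complex.I) * (((τ ^ (-ν) : ℝ) : ℂ) /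
        (Complex.exp (-(θ / 2 * Complex.I)) + Complex.exp (θ / 2 * Complex.I) * τ)) := by
    have hfactor : Complex.exp (-(θ / 2 * Complex.I)) + Complex.exp (θ / 2 * Complex.I) * τ =
        Complex.exp (θ / 2 * Complex.I) * (Complex.exp (-(θ * Complex.I)) + τ) := by
      rw [mul_add, ← Complex.exp_add]
      ring_nf
    rw [hfactor, ← mul_div_assoc, mul_div_mul_left _ _ (Complex.exp_ne_zero _)]
  simp only [hrot]
  rw [integral_const_mul, integral_rpow_neg_div_add_mul (by simpa [Complex.exp_re] using hcos)
      (by simpa [Complex.exp_re] using hcos) h0 h1,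
    cexp_cpow (by rw [Complex.neg_im, him]; linarith) (by rw [Complex.neg_im, him]; linarith),
    cexp_cpow (by linarith) (by linarith), mul_left_comm, ← Complex.exp_add, ← Complex.exp_add]
  ring_nf

lemma normSq_cexp_neg_add (θ τ : ℝ) :
    Complex.normSq (Complex.exp (-(θ * Complex.I)) + τ) = 1 + 2 * τ * Real.cos θ + τ ^ 2 := by
  have h : Complex.exp (-(θ * Complex.I)) + τ =
      ((Real.cos θ + τ : ℝ) : ℂ) + ((-Real.sin θ : ℝ) : ℂ) * Complex.I := by
    rw [← neg_mul, Complex.exp_mul_I, Complex.cos_neg, Complex.sin_neg]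
    push_cast
    ring
  rw [h, Complex.normSq_add_mul_I]
  linear_combination Real.sin_sq_add_cos_sq θ

lemma neg_one_lt_cos {θ : ℝ} (hθ : |θ| < Real.pi) : -1 < Real.cos θ := by
  rw [← Real.cos_abs, ← Real.cos_pi]
  exact Real.cos_lt_cos_of_nonneg_of_le_pi (abs_nonneg θ) le_rfl hθ

lemma sin_mul_quadMellin_one {ν θ : ℝ} (h0 : 0 < ν) (h1 : ν < 1) (hθ : |θ| < Real.pi) :
    Real.sin θ * quadMellin 1 (1 - ν) θ = Real.pi / Real.sin (Real.pi * ν) * Real.sin (ν * θ) := by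
  have hsin : 0 < Real.sin (Real.pi * ν) :=
    Real.sin_pos_of_pos_of_lt_pi (by positivity) (by nlinarith [Real.pi_pos])
  have hpole : ∫ τ in Set.Ioi (0 : ℝ), ((τ ^ (-ν) : ℝ) : ℂ) /
      (Complex.exp (-(θ * Complex.I)) + τ) =
      ((Real.pi / Real.sin (Real.pi * ν) : ℝ) : ℂ) * Complex.exp ((ν * θ : ℝ) * Complex.I) := by
    push_cast
    exact integral_rpow_neg_div_cexp_neg_add h0 h1 hθ
  have hint : Integrable (fun τ : ℝ => ((τ ^ (-ν) : ℝ) : ℂ) /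
      (Complex.exp (-(θ * Complex.I)) + τ)) (volume.restrict (Set.Ioi 0)) := by
    refine Integrable.of_integral_ne_zero ?_
    rw [hpole]
    exact mul_ne_zero (Complex.ofReal_ne_zero.mpr (by positivity)) (Complex.exp_ne_zero _)
  have him (τ : ℝ) : (((τ ^ (-ν) : ℝ) : ℂ) / (Complex.exp (-(θ * Complex.I)) + τ)).im =
      Real.sin θ * (τ ^ (1 - ν - 1) * (1 + 2 * τ * Real.cos θ + τ ^ 2) ^ (-1 : ℝ)) := by
    rw [div_eq_mul_inv, Complex.im_ofReal_mul, Complex.inv_im, normSq_cexp_neg_add, ← neg_mul,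
      ← Complex.ofReal_neg, Complex.add_im, Complex.exp_ofReal_mul_I_im, Complex.ofReal_im,
      Real.sin_neg, Real.rpow_neg_one, sub_sub_cancel_left]
    ring
  calc
    _ = (∫ τ in Set.Ioi (0 : ℝ), ((τ ^ (-ν) : ℝ) : ℂ) /
        (Complex.exp (-(θ * Complex.I)) + τ)).im := by
      rw [quadMellin, ← integral_const_mul, ← RCLike.im_eq_complex_im, ← integral_im hint]
      simp only [RCLike.im_eq_complex_im, him]
    _ = _ := by rw [hpole, Complex.im_ofReal_mul, Complex.exp_ofReal_mul_I_im]

end QuadMellin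

section TrigSum

/-- The numerator of the closed form of `sin θ ^ (2 N + 1) * quadMellin (N + 1) (N + 1 - ν) θ`, a
sine polynomial with frequencies `ν + N - 2 i`. -/
noncomputable def trigSum (N : ℕ) (ν θ : ℝ) : ℝ :=
  ∑ i ∈ Finset.range (N + 1), (trigCoeff N i).eval ν * Real.sin ((ν + N - 2 * i) * θ)

lemma hasDerivAt_trigSum (N : ℕ) (ν θ : ℝ) :
    HasDerivAt (trigSum N ν) (∑ i ∈ Finset.range (N + 1), (trigCoeff N i).eval ν *
      ((ν + N - 2 * i) * Real.cos ((ν + N - 2 * i) * θ))) θ := by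
  unfold trigSum
  refine HasDerivAt.fun_sum fun i _ => ?_
  refine (((hasDerivAt_id θ).const_mul (ν + N - 2 * i)).sin.const_mul _).congr_deriv ?_
  rw [id, mul_one]
  ring

lemma trigSum_succ (N : ℕ) (ν θ : ℝ) :
    trigSum (N + 1) ν θ =
      2 * (Real.sin θ * deriv (trigSum N ν) θ - (2 * N + 1) * Real.cos θ * trigSum N ν θ) := by
  have hsum := congrArg (Polynomial.eval ν) (sum_mul_trigCoeff_succ N
    fun i => Polynomial.C (Real.sin ((ν + N + 1 - 2 * i) * θ)))
  simp only [Polynomial.eval_finsetSum, Polynomial.eval_mul, Polynomial.eval_sub,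
    Polynomial.eval_add, Polynomial.eval_C, Polynomial.eval_X] at hsum
  have hlhs : trigSum (N + 1) ν θ = ∑ i ∈ Finset.range (N + 2),
      Real.sin ((ν + N + 1 - 2 * i) * θ) * (trigCoeff (N + 1) i).eval ν :=
    Finset.sum_congr rfl fun i _ => by rw [mul_comm, Nat.cast_add_one, add_assoc ν]
  rw [hlhs, hsum, (hasDerivAt_trigSum N ν θ).deriv, trigSum, Finset.mul_sum, Finset.mul_sum,
    ← Finset.sum_sub_distrib, Finset.mul_sum]
  refine Finset.sum_congr rfl fun i _ => ?_
  rw [show (ν + N + 1 - 2 * i) * θ = (ν + N - 2 * i) * θ + θ by ring,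
    show (ν + N + 1 - 2 * (i + 1 : ℕ)) * θ = (ν + N - 2 * i) * θ - θ by push_cast; ring,
    Real.sin_add, Real.sin_sub]
  ring

lemma sin_pow_mul_quadMellin {ν : ℝ} (h0 : 0 < ν) (h1 : ν < 1) (N : ℕ) {θ : ℝ}
    (hθ : θ ∈ Set.Ioo 0 Real.pi) :
    Real.sin θ ^ (2 * N + 1) * quadMellin (N + 1) (N + 1 - ν) θ =
      Real.pi / Real.sin (Real.pi * ν) / (4 ^ N * N.factorial) * trigSum N ν θ := by
  induction N generalizing θ with
  | zero =>
    simpa [trigSum, trigCoeff_zero_zero] using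
      sin_mul_quadMellin_one h0 h1 (abs_lt.mpr ⟨by linarith [hθ.1, Real.pi_pos], hθ.2⟩)
  | succ N ih =>
    set K : ℝ := Real.pi / Real.sin (Real.pi * ν) / (4 ^ N * N.factorial) with hK
    have hcos := neg_one_lt_cos (abs_lt.mpr ⟨by linarith [hθ.1, Real.pi_pos], hθ.2⟩)
    have hquad := hasDerivAt_quadMellin (Δ := N + 1) (σ := N + 1 - ν)
      (by linarith [N.cast_nonneg (α := ℝ)]) (by linarith [N.cast_nonneg (α := ℝ)]) hcos
    have hprod := ((Real.hasDerivAt_sin θ).pow (2 * N + 1)).mul hquad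
    have htrig := (hasDerivAt_trigSum N ν θ).differentiableAt.hasDerivAt.const_mul K
    have heq : Real.sin ^ (2 * N + 1) * quadMellin (N + 1) (N + 1 - ν) =ᶠ[𝓝 θ]
        fun x => K * trigSum N ν x := by
      filter_upwards [isOpen_Ioo.mem_nhds hθ] with x hx
      exact ih hx
    have hderiv := hprod.unique (htrig.congr_of_eventuallyEq heq)
    simp only [Pi.pow_apply, Nat.add_sub_cancel] at hderiv
    rw [trigSum_succ, Nat.factorial_succ]
    have hih := ih hθ
    push_cast at hderiv ⊢
    rw [show (N : ℝ) + 1 + 1 - ν = N + 1 - ν + 1 by ring]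
    have hK' : Real.pi / Real.sin (Real.pi * ν) / (4 ^ (N + 1) * ((N + 1) * N.factorial)) =
        K / (4 * (N + 1)) := by
      rw [hK, pow_succ]
      field_simp
    rw [hK', div_mul_eq_mul_div, eq_div_iff (by positivity)]
    linear_combination 2 * Real.sin θ * hderiv - 2 * (2 * N + 1) * Real.cos θ * hih

lemma integral_cos_mul_add {c : ℝ} (hc : c ≠ 0) (d T : ℝ) :
    ∫ θ in (0 : ℝ)..T, Real.cos (c * θ + d) = (Real.sin (c * T + d) - Real.sin d) / c := by
  rw [intervalIntegral.integral_comp_mul_add _ hc, integral_cos, smul_eq_mul, mul_zero, zero_add,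
    inv_mul_eq_div]

lemma sin_mul_mul_sin_mul_sub (a b T θ : ℝ) :
    Real.sin (a * θ) * Real.sin (b * (T - θ)) =
      (Real.cos ((a + b) * θ + -(b * T)) - Real.cos ((a - b) * θ + b * T)) / 2 := by
  rw [show (a + b) * θ + -(b * T) = a * θ - b * (T - θ) by ring,
    show (a - b) * θ + b * T = a * θ + b * (T - θ) by ring, Real.cos_sub, Real.cos_add]
  ring

lemma integral_sin_mul_mul_sin_mul_sub {a b : ℝ} (hadd : a + b ≠ 0) (hsub : a - b ≠ 0) (T : ℝ) :
    ∫ θ in (0 : ℝ)..T, Real.sin (a * θ) * Real.sin (b * (T - θ)) =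
      ((Real.sin (a * T) + Real.sin (b * T)) / (a + b) -
        (Real.sin (a * T) - Real.sin (b * T)) / (a - b)) / 2 := by
  simp only [sin_mul_mul_sin_mul_sub]
  rw [intervalIntegral.integral_div, intervalIntegral.integral_sub
    (Continuous.intervalIntegrable (by fun_prop) _ _)
    (Continuous.intervalIntegrable (by fun_prop) _ _), integral_cos_mul_add hadd,
    integral_cos_mul_add hsub, Real.sin_neg]
  ring_nf

lemma integral_sin_mul_mul_sin_mul_sub_self {a : ℝ} (ha : a ≠ 0) (T : ℝ) :
    ∫ θ in (0 : ℝ)..T, Real.sin (a * θ) * Real.sin (a * (T - θ)) =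
      (Real.sin (a * T) / a - T * Real.cos (a * T)) / 2 := by
  simp only [sin_mul_mul_sin_mul_sub, sub_self, zero_mul, zero_add]
  rw [intervalIntegral.integral_div, intervalIntegral.integral_sub
    (Continuous.intervalIntegrable (by fun_prop) _ _) intervalIntegrable_const,
    integral_cos_mul_add (c := a + a) (by simpa using ha), intervalIntegral.integral_const,
    Real.sin_neg, smul_eq_mul, sub_zero, ← two_mul]
  field_simp
  ring_nf

lemma integral_sin_freq_mul_sin_freq (N i j : ℕ) {ν : ℝ} (hν : ∀ m : ℤ, ν ≠ m) :
    ∫ θ in (0 : ℝ)..Real.pi, Real.sin ((ν + N - 2 * i) * θ) *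
        Real.sin ((ν + N - 2 * j) * (Real.pi - θ)) =
      (-1) ^ N / 2 * (Real.sin (Real.pi * ν) / (ν - (i + j - N)) -
        if i = j then Real.pi * Real.cos (Real.pi * ν) else 0) := by
  have hfreq (k : ℕ) : (ν + N - 2 * k) * Real.pi =
      Real.pi * ν + N * Real.pi - k * (2 * Real.pi) := by ring
  have hne : ν - ((i : ℝ) + j - N) ≠ 0 := by
    have := hν (i + j - N)
    push_cast at this
    exact sub_ne_zero.mpr this
  rcases eq_or_ne i j with rfl | hij
  · have hsum : ν - ((i : ℝ) + i - N) = ν + N - 2 * i := by ring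
    rw [integral_sin_mul_mul_sin_mul_sub_self (hsum ▸ hne), if_pos rfl, hfreq,
      Real.sin_sub_nat_mul_two_pi, Real.cos_sub_nat_mul_two_pi, Real.sin_add_nat_mul_pi,
      Real.cos_add_nat_mul_pi, hsum]
    ring
  · have hsum : (ν + N - 2 * i) + (ν + N - 2 * j) = 2 * (ν - ((i : ℝ) + j - N)) := by ring
    have hdiff : (ν + N - 2 * i) - (ν + N - 2 * j) ≠ 0 := by
      rw [sub_sub_sub_cancel_left, sub_ne_zero]
      exact_mod_cast (by omega : 2 * j ≠ 2 * i)
    rw [integral_sin_mul_mul_sin_mul_sub (hsum ▸ mul_ne_zero two_ne_zero hne) hdiff, if_neg hij,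
      hfreq, hfreq, Real.sin_sub_nat_mul_two_pi, Real.sin_sub_nat_mul_two_pi,
      Real.sin_add_nat_mul_pi, hsum, sub_self, zero_div, ← two_mul,
      mul_div_mul_left _ _ two_ne_zero]
    ring

lemma integral_trigSum_mul_trigSum_pi_sub (N : ℕ) {ν : ℝ} (hν : ∀ m : ℤ, ν ≠ m) :
    ∫ θ in (0 : ℝ)..Real.pi, trigSum N ν θ * trigSum N ν (Real.pi - θ) =
      (-1) ^ N / 2 * (Real.sin (Real.pi * ν) * (∑ n ∈ Finset.range (2 * N + 1),
        (trigNormSq N).eval (n - N : ℝ) / (ν - (n - N))) -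
        Real.pi * Real.cos (Real.pi * ν) * (trigNormSq N).eval ν) := by
  have hexpand (θ : ℝ) : trigSum N ν θ * trigSum N ν (Real.pi - θ) =
      ∑ i ∈ Finset.range (N + 1), ∑ j ∈ Finset.range (N + 1),
        (trigCoeff N i).eval ν * (trigCoeff N j).eval ν * (Real.sin ((ν + N - 2 * i) * θ) *
          Real.sin ((ν + N - 2 * j) * (Real.pi - θ))) := by
    rw [trigSum, trigSum, Finset.sum_mul_sum]
    exact Finset.sum_congr rfl fun i _ => Finset.sum_congr rfl fun j _ => by ring
  have hdiag : ∑ i ∈ Finset.range (N + 1), ∑ j ∈ Finset.range (N + 1),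
      (trigCoeff N i).eval ν * (trigCoeff N j).eval ν *
        (if i = j then Real.pi * Real.cos (Real.pi * ν) else 0) =
      Real.pi * Real.cos (Real.pi * ν) * (trigNormSq N).eval ν := by
    rw [eval_trigNormSq, Finset.mul_sum]
    refine Finset.sum_congr rfl fun i hi => ?_
    simp only [mul_ite, mul_zero, Finset.sum_ite_eq, if_pos hi]
    ring
  have hint : ∫ θ in (0 : ℝ)..Real.pi, trigSum N ν θ * trigSum N ν (Real.pi - θ) =
      ∑ i ∈ Finset.range (N + 1), ∑ j ∈ Finset.range (N + 1),
        (trigCoeff N i).eval ν * (trigCoeff N j).eval ν * ∫ θ in (0 : ℝ)..Real.pi,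
          Real.sin ((ν + N - 2 * i) * θ) * Real.sin ((ν + N - 2 * j) * (Real.pi - θ)) := by
    simp_rw [hexpand]
    rw [intervalIntegral.integral_finsetSum fun i _ =>
      Continuous.intervalIntegrable (by fun_prop) _ _]
    refine Finset.sum_congr rfl fun i _ => ?_
    rw [intervalIntegral.integral_finsetSum fun j _ =>
      Continuous.intervalIntegrable (by fun_prop) _ _]
    simp only [intervalIntegral.integral_const_mul]
  rw [hint]
  simp only [integral_sin_freq_mul_sin_freq N _ _ hν]
  rw [← sum_trigCoeff_mul_div_eq_sum_trigNormSq_div N hν, ← hdiag, mul_sub]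
  simp only [Finset.mul_sum, ← Finset.sum_sub_distrib]
  exact Finset.sum_congr rfl fun i _ => Finset.sum_congr rfl fun j _ => by ring

end TrigSum

section FeynmanParameters

lemma lintegral_rpow_mul_exp_neg_mul {a r : ℝ} (ha : 0 < a) (hr : 0 < r) :
    ∫⁻ t in Set.Ioi (0 : ℝ), ENNReal.ofReal (t ^ (a - 1) * Real.exp (-(r * t))) =
      ENNReal.ofReal (r ^ (-a) * Real.Gamma a) := by
  rw [← ofReal_integral_eq_lintegral_ofReal (integrableOn_rpow_mul_exp_neg_mul ha hr),
    Real.integral_rpow_mul_exp_neg_mul_Ioi ha hr, one_div, Real.inv_rpow hr.le, Real.rpow_neg hr.le]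
  filter_upwards [ae_restrict_mem measurableSet_Ioi] with t ht
  exact mul_nonneg (Real.rpow_nonneg (Set.mem_Ioi.mp ht).le _) (Real.exp_pos _).le

lemma ofReal_abs_pow_finrank_mul_lintegral_comp_smul {E : Type*} [NormedAddCommGroup E]
    [NormedSpace ℝ E] [MeasurableSpace E] [BorelSpace E] [FiniteDimensional ℝ E] (μ : Measure E)
    [μ.IsAddHaarMeasure] {f : E → ENNReal} (hf : Measurable f) {r : ℝ} (hr : r ≠ 0) :
    ENNReal.ofReal |r ^ Module.finrank ℝ E| * ∫⁻ x, f (r • x) ∂μ = ∫⁻ x, f x ∂μ := by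
  rw [← lintegral_map hf (measurable_const_smul r), Measure.map_addHaar_smul μ hr,
    lintegral_smul_measure, smul_eq_mul, ← mul_assoc, ← ENNReal.ofReal_mul (abs_nonneg _),
    ← abs_mul, mul_inv_cancel₀ (pow_ne_zero _ hr), abs_one, ENNReal.ofReal_one, one_mul]

lemma lintegral_Ioi_eq_mul_lintegral_comp_mul {f : ℝ → ENNReal} (hf : Measurable f) {r : ℝ}
    (hr : 0 < r) :
    ∫⁻ t in Set.Ioi (0 : ℝ), f t = ENNReal.ofReal r * ∫⁻ τ in Set.Ioi (0 : ℝ), f (r * τ) := by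
  rw [← lintegral_indicator measurableSet_Ioi, ← lintegral_indicator measurableSet_Ioi,
    ← ofReal_abs_pow_finrank_mul_lintegral_comp_smul volume (hf.indicator measurableSet_Ioi) hr.ne',
    Module.finrank_self, pow_one, abs_of_pos hr]
  simp only [Set.indicator_apply, Set.mem_Ioi, smul_eq_mul, mul_pos_iff_of_pos_left hr]

lemma lintegral_lintegral_eq_lintegral_sq_mul_lintegral_scale {f : ℝ × ℝ × ℝ → ENNReal}
    (hf : Measurable f) :
    ∫⁻ p : ℝ × ℝ, ∫⁻ z, f (p.1, p.2, z) =
      ∫⁻ ρ : ℝ, ENNReal.ofReal (ρ ^ 2) *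
        ∫⁻ p : ℝ × ℝ, f (ρ * p.1, ρ * p.2, ρ * (1 - p.1 - p.2)) := by
  calc ∫⁻ p : ℝ × ℝ, ∫⁻ z, f (p.1, p.2, z)
      = ∫⁻ p : ℝ × ℝ, ∫⁻ ρ, f (p.1, p.2, ρ - (p.1 + p.2)) :=
        lintegral_congr fun p =>
          (lintegral_sub_right_eq_self (fun z => f (p.1, p.2, z)) (p.1 + p.2)).symm
    _ = ∫⁻ ρ, ∫⁻ p : ℝ × ℝ, f (p.1, p.2, ρ - (p.1 + p.2)) :=
        lintegral_lintegral_swap (by fun_prop)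
    _ = _ := by
        refine lintegral_congr_ae ?_
        filter_upwards [Measure.ae_ne volume 0] with ρ hρ
        rw [← ofReal_abs_pow_finrank_mul_lintegral_comp_smul volume (by fun_prop) hρ,
          Module.finrank_prod, Module.finrank_self, one_add_one_eq_two, abs_sq]
        simp only [Prod.smul_fst, Prod.smul_snd, smul_eq_mul]
        congr! 6
        ring

/-- The parameter domain of a three-point Feynman integral: the points `(α, β)` for which
`α`, `β` and `1 - α - β` are positive. -/
def openTriangle : Set (ℝ × ℝ) := {p | 0 < p.1 ∧ 0 < p.2 ∧ p.1 + p.2 < 1}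

lemma measurableSet_openTriangle : MeasurableSet openTriangle :=
  (measurableSet_lt measurable_const measurable_fst).inter
    ((measurableSet_lt measurable_const measurable_snd).inter
      (measurableSet_lt (measurable_fst.add measurable_snd) measurable_const))

lemma one_sub_sub_pos_of_mem_openTriangle {p : ℝ × ℝ} (hp : p ∈ openTriangle) :
    0 < 1 - p.1 - p.2 := by
  linarith [hp.2.2]

lemma indicator_Ioi_mul_mul_scale (g₁ g₂ g₃ : ℝ → ENNReal) (ρ : ℝ) (p : ℝ × ℝ) :
    (Set.Ioi 0).indicator g₁ (ρ * p.1) * ((Set.Ioi 0).indicator g₂ (ρ * p.2) *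
        (Set.Ioi 0).indicator g₃ (ρ * (1 - p.1 - p.2))) =
      (Set.Ioi 0).indicator (fun ρ => openTriangle.indicator (fun p =>
        g₁ (ρ * p.1) * (g₂ (ρ * p.2) * g₃ (ρ * (1 - p.1 - p.2)))) p) ρ := by
  rcases lt_or_ge 0 ρ with hρ | hρ
  · rw [Set.indicator_of_mem (Set.mem_Ioi.mpr hρ)]
    simp only [Set.indicator_apply, Set.mem_Ioi, mul_pos_iff_of_pos_left hρ]
    have hiff : p ∈ openTriangle ↔ 0 < p.1 ∧ 0 < p.2 ∧ 0 < 1 - p.1 - p.2 := by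
      rw [sub_sub, sub_pos]; rfl
    split_ifs <;> simp_all
  · rw [Set.indicator_of_notMem (Set.notMem_Ioi.mpr hρ)]
    by_contra hne
    simp only [mul_eq_zero, Set.indicator_apply_eq_zero, Set.mem_Ioi, not_or, Classical.not_imp]
      at hne
    linarith [hne.1.1, hne.2.1.1, hne.2.2.1]

lemma lintegral_Ioi_mul_mul_eq_lintegral_openTriangle {g₁ g₂ g₃ : ℝ → ENNReal}
    (h₁ : Measurable g₁) (h₂ : Measurable g₂) (h₃ : Measurable g₃) :
    (∫⁻ x in Set.Ioi (0 : ℝ), g₁ x) *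
        ((∫⁻ y in Set.Ioi (0 : ℝ), g₂ y) * ∫⁻ z in Set.Ioi (0 : ℝ), g₃ z) =
      ∫⁻ p in openTriangle, ∫⁻ ρ in Set.Ioi (0 : ℝ), ENNReal.ofReal (ρ ^ 2) *
        (g₁ (ρ * p.1) * (g₂ (ρ * p.2) * g₃ (ρ * (1 - p.1 - p.2)))) := by
  have hm₁ := h₁.indicator (measurableSet_Ioi (a := (0 : ℝ)))
  have hm₂ := h₂.indicator (measurableSet_Ioi (a := (0 : ℝ)))
  have hm₃ := h₃.indicator (measurableSet_Ioi (a := (0 : ℝ)))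
  have hscale := lintegral_lintegral_eq_lintegral_sq_mul_lintegral_scale (f := fun q =>
    (Set.Ioi 0).indicator g₁ q.1 * ((Set.Ioi 0).indicator g₂ q.2.1 *
      (Set.Ioi 0).indicator g₃ q.2.2)) (by fun_prop)
  have hprod : ∫⁻ p : ℝ × ℝ, ∫⁻ z, (Set.Ioi 0).indicator g₁ p.1 *
      ((Set.Ioi 0).indicator g₂ p.2 * (Set.Ioi 0).indicator g₃ z) =
      (∫⁻ x in Set.Ioi (0 : ℝ), g₁ x) *
        ((∫⁻ y in Set.Ioi (0 : ℝ), g₂ y) * ∫⁻ z in Set.Ioi (0 : ℝ), g₃ z) := by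
    simp_rw [← mul_assoc, lintegral_const_mul _ hm₃]
    rw [lintegral_mul_const _ (by fun_prop), Measure.volume_eq_prod,
      lintegral_prod_mul hm₁.aemeasurable hm₂.aemeasurable]
    simp only [lintegral_indicator measurableSet_Ioi]
  rw [← hprod, hscale, lintegral_lintegral_swap (by fun_prop),
    ← lintegral_indicator measurableSet_Ioi]
  refine lintegral_congr fun ρ => ?_
  simp only [indicator_Ioi_mul_mul_scale]
  by_cases hρ : ρ ∈ Set.Ioi 0
  · simp only [Set.indicator_of_mem hρ]
    rw [lintegral_indicator measurableSet_openTriangle, lintegral_const_mul _ (by fun_prop)]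
  · simp [hρ]

lemma rpow_mul_exp_eq_sq_mul_scale (a b c A B C : ℝ) {x y z ρ : ℝ} (hx : 0 ≤ x) (hy : 0 ≤ y)
    (hz : 0 ≤ z) (hρ : 0 < ρ) :
    x ^ (a - 1) * y ^ (b - 1) * z ^ (c - 1) *
        (ρ ^ (a + b + c - 1) * Real.exp (-(ρ * (x * A + y * B + z * C)))) =
      ρ ^ 2 * ((ρ * x) ^ (a - 1) * Real.exp (-(A * (ρ * x))) *
        ((ρ * y) ^ (b - 1) * Real.exp (-(B * (ρ * y))) *
          ((ρ * z) ^ (c - 1) * Real.exp (-(C * (ρ * z)))))) := by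
  have hexp : Real.exp (-(ρ * (x * A + y * B + z * C))) =
      Real.exp (-(A * (ρ * x))) * (Real.exp (-(B * (ρ * y))) * Real.exp (-(C * (ρ * z)))) := by
    rw [← Real.exp_add, ← Real.exp_add]
    congr 1
    ring
  have hpow : ρ ^ (a + b + c - 1) = ρ ^ 2 * (ρ ^ (a - 1) * (ρ ^ (b - 1) * ρ ^ (c - 1))) := by
    rw [← Real.rpow_two, ← Real.rpow_add hρ, ← Real.rpow_add hρ, ← Real.rpow_add hρ]
    congr 1
    ring
  rw [hexp, hpow, Real.mul_rpow hρ.le hx, Real.mul_rpow hρ.le hy, Real.mul_rpow hρ.le hz]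
  ring

lemma lintegral_openTriangle_feynman {a₁ a₂ a₃ A₁ A₂ A₃ : ℝ} (ha₁ : 0 < a₁) (ha₂ : 0 < a₂)
    (ha₃ : 0 < a₃) (hA₁ : 0 < A₁) (hA₂ : 0 < A₂) (hA₃ : 0 < A₃) :
    ∫⁻ p in openTriangle, ∫⁻ ρ in Set.Ioi (0 : ℝ), ENNReal.ofReal
      (p.1 ^ (a₁ - 1) * p.2 ^ (a₂ - 1) * (1 - p.1 - p.2) ^ (a₃ - 1) * (ρ ^ (a₁ + a₂ + a₃ - 1) *
        Real.exp (-(ρ * (p.1 * A₁ + p.2 * A₂ + (1 - p.1 - p.2) * A₃))))) =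
    ENNReal.ofReal (Real.Gamma a₁ * Real.Gamma a₂ * Real.Gamma a₃ *
      (A₁ ^ (-a₁) * A₂ ^ (-a₂) * A₃ ^ (-a₃))) := by
  have hprod := lintegral_Ioi_mul_mul_eq_lintegral_openTriangle
    (g₁ := fun x => ENNReal.ofReal (x ^ (a₁ - 1) * Real.exp (-(A₁ * x))))
    (g₂ := fun x => ENNReal.ofReal (x ^ (a₂ - 1) * Real.exp (-(A₂ * x))))
    (g₃ := fun x => ENNReal.ofReal (x ^ (a₃ - 1) * Real.exp (-(A₃ * x))))
    (by fun_prop) (by fun_prop) (by fun_prop)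
  rw [lintegral_rpow_mul_exp_neg_mul ha₁ hA₁, lintegral_rpow_mul_exp_neg_mul ha₂ hA₂,
    lintegral_rpow_mul_exp_neg_mul ha₃ hA₃, ← ENNReal.ofReal_mul (by positivity),
    ← ENNReal.ofReal_mul (by positivity)] at hprod
  calc _ = _ := ?_
    _ = _ := hprod.symm
    _ = _ := by congr 1; ring
  refine setLIntegral_congr_fun measurableSet_openTriangle fun p hp =>
    setLIntegral_congr_fun measurableSet_Ioi fun ρ hρ => ?_
  have hp₁ : 0 < p.1 := hp.1
  have hp₂ : 0 < p.2 := hp.2.1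
  have hp₃ := one_sub_sub_pos_of_mem_openTriangle hp
  replace hρ : 0 < ρ := hρ
  generalize 1 - p.1 - p.2 = q at hp₃ ⊢
  rw [← ENNReal.ofReal_mul (by positivity), ← ENNReal.ofReal_mul (by positivity),
    ← ENNReal.ofReal_mul (by positivity)]
  congr 1
  exact rpow_mul_exp_eq_sq_mul_scale a₁ a₂ a₃ A₁ A₂ A₃ hp₁.le hp₂.le hp₃.le hρ

end FeynmanParameters

section ContactIntegral

/-- The upper half-plane in real coordinates. -/
def openHalfPlane : Set (ℝ × ℝ) := Set.univ ×ˢ Set.Ioi 0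

lemma measurableSet_openHalfPlane : MeasurableSet openHalfPlane :=
  MeasurableSet.univ.prod measurableSet_Ioi

lemma lintegral_rpow_mul_exp_neg_mul_sq {b r : ℝ} (hb : -1 < b) (hr : 0 < r) :
    ∫⁻ y in Set.Ioi (0 : ℝ), ENNReal.ofReal (y ^ b * Real.exp (-(r * y ^ 2))) =
      ENNReal.ofReal (r ^ (-(b + 1) / 2) * (1 / 2) * Real.Gamma ((b + 1) / 2)) := by
  have hint := integrableOn_rpow_mul_exp_neg_mul_rpow hb two_pos hr
  have hval := integral_rpow_mul_exp_neg_mul_rpow two_pos hb hr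
  simp only [Real.rpow_two, neg_mul] at hint hval
  rw [← hval, ofReal_integral_eq_lintegral_ofReal hint]
  filter_upwards [ae_restrict_mem measurableSet_Ioi] with y hy
  exact mul_nonneg (Real.rpow_nonneg (Set.mem_Ioi.mp hy).le _) (Real.exp_pos _).le

lemma lintegral_exp_neg_mul_sq_sub {r : ℝ} (hr : 0 < r) (a : ℝ) :
    ∫⁻ x : ℝ, ENNReal.ofReal (Real.exp (-(r * (x - a) ^ 2))) =
      ENNReal.ofReal (√(Real.pi / r)) := by
  have hint := integrable_exp_neg_mul_sq hr
  have hval := integral_gaussian r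
  simp only [neg_mul] at hint hval
  rw [lintegral_sub_right_eq_self (fun x => ENNReal.ofReal (Real.exp (-(r * x ^ 2)))) a, ← hval,
    ofReal_integral_eq_lintegral_ofReal hint (Eventually.of_forall fun _ => (Real.exp_pos _).le)]

lemma lintegral_openHalfPlane_rpow_mul_exp {b r : ℝ} (hb : -1 < b) (hr : 0 < r) (a : ℝ) :
    ∫⁻ w in openHalfPlane,
        ENNReal.ofReal (w.2 ^ b * Real.exp (-(r * ((w.1 - a) ^ 2 + w.2 ^ 2)))) =
      ENNReal.ofReal (√Real.pi * Real.Gamma ((b + 1) / 2) / 2 * r ^ (-(b + 2) / 2)) := by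
  have hpow : r ^ (-(b + 1) / 2) / √r = r ^ (-(b + 2) / 2) := by
    rw [Real.sqrt_eq_rpow, ← Real.rpow_sub hr]
    congr 1
    ring
  calc _ = ∫⁻ w in openHalfPlane, ENNReal.ofReal (Real.exp (-(r * (w.1 - a) ^ 2))) *
        ENNReal.ofReal (w.2 ^ b * Real.exp (-(r * w.2 ^ 2))) :=
      lintegral_congr fun w => by
        rw [← ENNReal.ofReal_mul (Real.exp_pos _).le, mul_add, neg_add, Real.exp_add]
        congr 1
        ring
    _ = ENNReal.ofReal (√(Real.pi / r)) *
        ENNReal.ofReal (r ^ (-(b + 1) / 2) * (1 / 2) * Real.Gamma ((b + 1) / 2)) := by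
      rw [openHalfPlane, Measure.volume_eq_prod, ← Measure.prod_restrict, Measure.restrict_univ,
        lintegral_prod_mul (f := fun x => ENNReal.ofReal (Real.exp (-(r * (x - a) ^ 2))))
          (g := fun y => ENNReal.ofReal (y ^ b * Real.exp (-(r * y ^ 2))))
          (by fun_prop) (by fun_prop),
        lintegral_exp_neg_mul_sq_sub hr, lintegral_rpow_mul_exp_neg_mul_sq hb hr]
    _ = _ := by
      rw [← ENNReal.ofReal_mul (Real.sqrt_nonneg _), Real.sqrt_div Real.pi_pos.le, ← hpow]
      congr 1
      ring

/-- The integrand of the contact diagram in `AdS₂`: the product of the bulk-to-boundary propagators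
`(y / ((x - xᵢ) ^ 2 + y ^ 2)) ^ Δ` from the boundary points `x₁, x₂, x₃` and `y ^ Δ` from infinity,
against the hyperbolic area `dx dy / y ^ 2`, at `w = (x, y)`. -/
noncomputable def contactIntegrand (Δ x₁ x₂ x₃ : ℝ) (w : ℝ × ℝ) : ℝ :=
  w.2 ^ (4 * Δ - 2) * (((w.1 - x₁) ^ 2 + w.2 ^ 2) ^ (-Δ) * ((w.1 - x₂) ^ 2 + w.2 ^ 2) ^ (-Δ) *
    ((w.1 - x₃) ^ 2 + w.2 ^ 2) ^ (-Δ))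

/-- The contact diagram in `AdS₂` with boundary points `x₁, x₂, x₃, ∞` and equal weights `Δ`. -/
noncomputable def contactIntegral (Δ x₁ x₂ x₃ : ℝ) : ENNReal :=
  ∫⁻ w in openHalfPlane, ENNReal.ofReal (contactIntegrand Δ x₁ x₂ x₃ w)

/-- The quadratic form `∑ i < j, pᵢ pⱼ (xᵢ - xⱼ) ^ 2` in the Feynman parameters
`p₁, p₂, p₃ = 1 - p₁ - p₂`. -/
def feynmanForm (x₁ x₂ x₃ : ℝ) (p : ℝ × ℝ) : ℝ :=
  p.1 * p.2 * (x₁ - x₂) ^ 2 + p.1 * (1 - p.1 - p.2) * (x₁ - x₃) ^ 2 +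
    p.2 * (1 - p.1 - p.2) * (x₂ - x₃) ^ 2

lemma feynmanForm_pos {x₁ x₂ : ℝ} (h : x₁ ≠ x₂) (x₃ : ℝ) {p : ℝ × ℝ} (hp : p ∈ openTriangle) :
    0 < feynmanForm x₁ x₂ x₃ p := by
  have hp₁ : 0 < p.1 := hp.1
  have hp₂ : 0 < p.2 := hp.2.1
  have hp₃ := one_sub_sub_pos_of_mem_openTriangle hp
  have := sub_ne_zero.mpr h
  unfold feynmanForm
  positivity

lemma sum_mul_sq_sub_add_sq (x₁ x₂ x₃ : ℝ) (p w : ℝ × ℝ) :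
    p.1 * ((w.1 - x₁) ^ 2 + w.2 ^ 2) + p.2 * ((w.1 - x₂) ^ 2 + w.2 ^ 2) +
        (1 - p.1 - p.2) * ((w.1 - x₃) ^ 2 + w.2 ^ 2) =
      feynmanForm x₁ x₂ x₃ p +
        ((w.1 - (p.1 * x₁ + p.2 * x₂ + (1 - p.1 - p.2) * x₃)) ^ 2 + w.2 ^ 2) := by
  unfold feynmanForm
  ring

/-- The integrand of the contact diagram after Feynman parametrization: `p` are the Feynman
parameters and `ρ` is their overall scale. -/
noncomputable def contactParamIntegrand (Δ x₁ x₂ x₃ : ℝ) (w p : ℝ × ℝ) (ρ : ℝ) : ℝ :=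
  w.2 ^ (4 * Δ - 2) * (p.1 ^ (Δ - 1) * p.2 ^ (Δ - 1) * (1 - p.1 - p.2) ^ (Δ - 1) *
    (ρ ^ (Δ + Δ + Δ - 1) * Real.exp (-(ρ * (p.1 * ((w.1 - x₁) ^ 2 + w.2 ^ 2) +
      p.2 * ((w.1 - x₂) ^ 2 + w.2 ^ 2) + (1 - p.1 - p.2) * ((w.1 - x₃) ^ 2 + w.2 ^ 2))))))

lemma measurable_contactParamIntegrand (Δ x₁ x₂ x₃ : ℝ) :
    Measurable fun q : ((ℝ × ℝ) × ℝ × ℝ) × ℝ =>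
      contactParamIntegrand Δ x₁ x₂ x₃ q.1.1 q.1.2 q.2 := by
  unfold contactParamIntegrand
  fun_prop

variable {Δ : ℝ}

lemma lintegral_contactParamIntegrand_param (hΔ : 0 < Δ) (x₁ x₂ x₃ : ℝ) {w : ℝ × ℝ}
    (hw : w ∈ openHalfPlane) :
    ∫⁻ p in openTriangle, ∫⁻ ρ in Set.Ioi (0 : ℝ),
        ENNReal.ofReal (contactParamIntegrand Δ x₁ x₂ x₃ w p ρ) =
      ENNReal.ofReal (Real.Gamma Δ ^ 3) * ENNReal.ofReal (contactIntegrand Δ x₁ x₂ x₃ w) := by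
  have hw₂ : 0 < w.2 := hw.2
  simp_rw [contactParamIntegrand, ENNReal.ofReal_mul (Real.rpow_nonneg hw₂.le (4 * Δ - 2)),
    lintegral_const_mul' _ _ ENNReal.ofReal_ne_top]
  rw [lintegral_openTriangle_feynman hΔ hΔ hΔ (by positivity) (by positivity) (by positivity),
    contactIntegrand, ← ENNReal.ofReal_mul (by positivity), ← ENNReal.ofReal_mul (by positivity)]
  congr 1
  ring

lemma lintegral_contactParamIntegrand_halfPlane (hΔ : 1 / 4 < Δ) (x₁ x₂ x₃ : ℝ) {p : ℝ × ℝ}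
    (hp : p ∈ openTriangle) {ρ : ℝ} (hρ : 0 < ρ) :
    ∫⁻ w in openHalfPlane, ENNReal.ofReal (contactParamIntegrand Δ x₁ x₂ x₃ w p ρ) =
      ENNReal.ofReal (√Real.pi * Real.Gamma (2 * Δ - 1 / 2) / 2 *
          (p.1 ^ (Δ - 1) * p.2 ^ (Δ - 1) * (1 - p.1 - p.2) ^ (Δ - 1))) *
        ENNReal.ofReal (ρ ^ (Δ - 1) * Real.exp (-(feynmanForm x₁ x₂ x₃ p * ρ))) := by
  have hp₁ : 0 < p.1 := hp.1
  have hp₂ : 0 < p.2 := hp.2.1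
  have hp₃ := one_sub_sub_pos_of_mem_openTriangle hp
  have hΓ : 0 < Real.Gamma (2 * Δ - 1 / 2) := Real.Gamma_pos_of_pos (by linarith)
  have hpow : ρ ^ (Δ - 1) = ρ ^ (Δ + Δ + Δ - 1) * ρ ^ (-(4 * Δ - 2 + 2) / 2) := by
    rw [← Real.rpow_add hρ]
    congr 1
    ring
  calc _ = ∫⁻ w in openHalfPlane, ENNReal.ofReal (p.1 ^ (Δ - 1) * p.2 ^ (Δ - 1) *
          (1 - p.1 - p.2) ^ (Δ - 1) *
            (ρ ^ (Δ + Δ + Δ - 1) * Real.exp (-(feynmanForm x₁ x₂ x₃ p * ρ)))) *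
        ENNReal.ofReal (w.2 ^ (4 * Δ - 2) * Real.exp (-(ρ *
          ((w.1 - (p.1 * x₁ + p.2 * x₂ + (1 - p.1 - p.2) * x₃)) ^ 2 + w.2 ^ 2)))) :=
      lintegral_congr fun w => by
        rw [contactParamIntegrand, sum_mul_sq_sub_add_sq, mul_add, neg_add, Real.exp_add,
          ← ENNReal.ofReal_mul (by positivity), mul_comm ρ (feynmanForm _ _ _ _)]
        congr 1
        ring
    _ = _ := by
      rw [lintegral_const_mul' _ _ ENNReal.ofReal_ne_top,
        lintegral_openHalfPlane_rpow_mul_exp (by linarith) hρ,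
        show (4 * Δ - 2 + 1) / 2 = 2 * Δ - 1 / 2 by ring, hpow,
        ← ENNReal.ofReal_mul (by positivity), ← ENNReal.ofReal_mul (by positivity)]
      congr 1
      ring

lemma contactIntegral_eq_lintegral_openTriangle (hΔ : 1 / 4 < Δ) {x₁ x₂ : ℝ} (h : x₁ ≠ x₂)
    (x₃ : ℝ) :
    contactIntegral Δ x₁ x₂ x₃ =
      ENNReal.ofReal (√Real.pi * Real.Gamma (2 * Δ - 1 / 2) / (2 * Real.Gamma Δ ^ 2)) *
        ∫⁻ p in openTriangle, ENNReal.ofReal (p.1 ^ (Δ - 1) * p.2 ^ (Δ - 1) *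
          (1 - p.1 - p.2) ^ (Δ - 1) * feynmanForm x₁ x₂ x₃ p ^ (-Δ)) := by
  have hΔ₀ : 0 < Δ := by linarith
  have hΓ : 0 < Real.Gamma Δ := Real.Gamma_pos_of_pos hΔ₀
  have hΓ' : 0 < Real.Gamma (2 * Δ - 1 / 2) := Real.Gamma_pos_of_pos (by linarith)
  have hΓ₃ : ENNReal.ofReal (Real.Gamma Δ ^ 3) ≠ 0 := by simpa using pow_pos hΓ 3
  have hmeas := measurable_contactParamIntegrand Δ x₁ x₂ x₃
  refine (ENNReal.mul_right_inj hΓ₃ ENNReal.ofReal_ne_top).mp ?_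
  calc ENNReal.ofReal (Real.Gamma Δ ^ 3) * contactIntegral Δ x₁ x₂ x₃
      = ∫⁻ w in openHalfPlane, ∫⁻ p in openTriangle, ∫⁻ ρ in Set.Ioi (0 : ℝ),
          ENNReal.ofReal (contactParamIntegrand Δ x₁ x₂ x₃ w p ρ) := by
        rw [contactIntegral, ← lintegral_const_mul' _ _ ENNReal.ofReal_ne_top]
        exact setLIntegral_congr_fun measurableSet_openHalfPlane fun w hw =>
          (lintegral_contactParamIntegrand_param hΔ₀ x₁ x₂ x₃ hw).symm
    _ = ∫⁻ p in openTriangle, ∫⁻ ρ in Set.Ioi (0 : ℝ), ∫⁻ w in openHalfPlane,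
          ENNReal.ofReal (contactParamIntegrand Δ x₁ x₂ x₃ w p ρ) := by
        rw [lintegral_lintegral_swap
          hmeas.ennreal_ofReal.lintegral_prod_right'.aemeasurable]
        refine lintegral_congr fun p => lintegral_lintegral_swap ?_
        exact (hmeas.comp (f := fun q : (ℝ × ℝ) × ℝ => ((q.1, p), q.2))
          (by fun_prop)).ennreal_ofReal.aemeasurable
    _ = _ := by
        rw [← mul_assoc, ← ENNReal.ofReal_mul (by positivity),
          ← lintegral_const_mul' _ _ ENNReal.ofReal_ne_top]
        refine setLIntegral_congr_fun measurableSet_openTriangle fun p hp => ?_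
        have hp₁ : 0 < p.1 := hp.1
        have hp₂ : 0 < p.2 := hp.2.1
        have hp₃ := one_sub_sub_pos_of_mem_openTriangle hp
        have hform := feynmanForm_pos h x₃ hp
        rw [setLIntegral_congr_fun measurableSet_Ioi fun ρ hρ =>
            lintegral_contactParamIntegrand_halfPlane hΔ x₁ x₂ x₃ hp hρ,
          lintegral_const_mul' _ _ ENNReal.ofReal_ne_top,
          lintegral_rpow_mul_exp_neg_mul hΔ₀ hform, ← ENNReal.ofReal_mul (by positivity),
          ← ENNReal.ofReal_mul (by positivity)]
        congr 1
        field_simp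

end ContactIntegral

section PolarMellin

variable {Δ σ : ℝ}

lemma polarCoord_symm_mem_openHalfPlane_iff {q : ℝ × ℝ} (hq : q ∈ polarCoord.target) :
    polarCoord.symm q ∈ openHalfPlane ↔ 0 < q.2 := by
  obtain ⟨hr, hθ⟩ := hq
  have hmem : polarCoord.symm q ∈ openHalfPlane ↔ 0 < Real.sin q.2 := by
    simp [openHalfPlane, mul_pos_iff_of_pos_left (Set.mem_Ioi.mp hr)]
  rw [hmem]
  refine ⟨fun h => ?_, fun h => Real.sin_pos_of_pos_of_lt_pi h hθ.2⟩
  contrapose! h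
  exact Real.sin_nonpos_of_nonpos_of_neg_pi_le h hθ.1.le

lemma lintegral_openHalfPlane_polar (f : ℝ × ℝ → ENNReal) :
    ∫⁻ w in openHalfPlane, f w = ∫⁻ q in Set.Ioi (0 : ℝ) ×ˢ Set.Ioo 0 Real.pi,
      ENNReal.ofReal q.1 * f (q.1 * Real.cos q.2, q.1 * Real.sin q.2) := by
  have hinter : openHalfPlane ∩ polarCoord.target = Set.Ioi (0 : ℝ) ×ˢ Set.Ioo 0 Real.pi := by
    ext q
    simp only [openHalfPlane, polarCoord_target, Set.mem_inter_iff, Set.mem_prod, Set.mem_univ,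
      Set.mem_Ioi, Set.mem_Ioo, true_and]
    exact ⟨fun h => ⟨h.2.1, h.1, h.2.2.2⟩,
      fun h => ⟨h.2.1, h.1, by linarith [Real.pi_pos, h.2.1], h.2.2⟩⟩
  rw [← lintegral_indicator measurableSet_openHalfPlane, ← lintegral_comp_polarCoord_symm,
    ← hinter, ← Measure.restrict_restrict measurableSet_openHalfPlane,
    ← lintegral_indicator measurableSet_openHalfPlane]
  refine setLIntegral_congr_fun polarCoord.open_target.measurableSet fun q hq => ?_
  have hiff : q ∈ openHalfPlane ↔ polarCoord.symm q ∈ openHalfPlane := by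
    rw [polarCoord_symm_mem_openHalfPlane_iff hq]
    simp [openHalfPlane]
  by_cases h : q ∈ openHalfPlane
  · rw [Set.indicator_of_mem (hiff.mp h), Set.indicator_of_mem h, smul_eq_mul,
      polarCoord_symm_apply]
  · rw [Set.indicator_of_notMem (mt hiff.mpr h), Set.indicator_of_notMem h, smul_zero]

lemma abs_lt_pi_of_mem_Ioo {θ : ℝ} (hθ : θ ∈ Set.Ioo 0 Real.pi) : |θ| < Real.pi :=
  (abs_of_pos hθ.1).trans_lt hθ.2

lemma pi_sub_mem_Ioo {θ : ℝ} (hθ : θ ∈ Set.Ioo 0 Real.pi) :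
    Real.pi - θ ∈ Set.Ioo 0 Real.pi :=
  ⟨sub_pos.mpr hθ.2, sub_lt_self _ hθ.1⟩

lemma quadMellin_nonneg {θ : ℝ} (Δ σ : ℝ) (hθ : -1 < Real.cos θ) : 0 ≤ quadMellin Δ σ θ :=
  setIntegral_nonneg measurableSet_Ioi fun _ hτ =>
    mul_nonneg (Real.rpow_nonneg (le_of_lt hτ) _)
      (Real.rpow_nonneg (one_add_two_mul_cos_add_sq_pos (le_of_lt hτ) hθ).le _)

lemma lintegral_rpow_mul_quad_rpow_neg {θ : ℝ} (h0 : 0 < σ) (h1 : σ < 2 * Δ)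
    (hθ : -1 < Real.cos θ) :
    ∫⁻ τ in Set.Ioi (0 : ℝ),
      ENNReal.ofReal (τ ^ (σ - 1) * (1 + 2 * τ * Real.cos θ + τ ^ 2) ^ (-Δ)) =
        ENNReal.ofReal (quadMellin Δ σ θ) := by
  rw [quadMellin, ofReal_integral_eq_lintegral_ofReal (integrableOn_quadMellin h0 h1 hθ)]
  filter_upwards [ae_restrict_mem measurableSet_Ioi] with τ hτ
  exact mul_nonneg (Real.rpow_nonneg (le_of_lt hτ) _)
    (Real.rpow_nonneg (one_add_two_mul_cos_add_sq_pos (le_of_lt hτ) hθ).le _)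

lemma contactIntegrand_polar {r τ θ : ℝ} (hr : 0 < r) (hτ : 0 < τ) (hθ : θ ∈ Set.Ioo 0 Real.pi) :
    r * ((r * τ) ^ (σ - 1) *
        (r * contactIntegrand Δ (r * τ) 0 (-1) (r * Real.cos θ, r * Real.sin θ))) =
      r ^ (σ - 1) * (1 + 2 * r * Real.cos θ + r ^ 2) ^ (-Δ) * Real.sin θ ^ (4 * Δ - 2) *
        (τ ^ (σ - 1) * (1 + 2 * τ * Real.cos (Real.pi - θ) + τ ^ 2) ^ (-Δ)) := by
  have hsin : 0 < Real.sin θ := Real.sin_pos_of_pos_of_lt_pi hθ.1 hθ.2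
  have hcos := neg_one_lt_cos (abs_lt_pi_of_mem_Ioo (pi_sub_mem_Ioo hθ))
  have hquad := one_add_two_mul_cos_add_sq_pos hτ.le hcos
  have h₁ : (r * Real.cos θ - r * τ) ^ 2 + (r * Real.sin θ) ^ 2 =
      r ^ 2 * (1 + 2 * τ * Real.cos (Real.pi - θ) + τ ^ 2) := by
    rw [Real.cos_pi_sub]
    linear_combination r ^ 2 * Real.sin_sq_add_cos_sq θ
  have h₂ : (r * Real.cos θ - 0) ^ 2 + (r * Real.sin θ) ^ 2 = r ^ 2 := by
    linear_combination r ^ 2 * Real.sin_sq_add_cos_sq θ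
  have h₃ : (r * Real.cos θ - -1) ^ 2 + (r * Real.sin θ) ^ 2 =
      1 + 2 * r * Real.cos θ + r ^ 2 := by
    linear_combination r ^ 2 * Real.sin_sq_add_cos_sq θ
  have hpow : r * (r * (r ^ (4 * Δ - 2) * ((r ^ 2) ^ (-Δ) * (r ^ 2) ^ (-Δ)))) = 1 := by
    rw [← Real.rpow_natCast r 2, ← Real.rpow_mul hr.le, ← Real.rpow_add hr, ← Real.rpow_add hr,
      ← mul_assoc, ← sq, ← Real.rpow_natCast r 2, ← Real.rpow_add hr,
      show ((2 : ℕ) : ℝ) + (4 * Δ - 2 + (((2 : ℕ) : ℝ) * -Δ + ((2 : ℕ) : ℝ) * -Δ)) = 0 by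
        push_cast; ring, Real.rpow_zero]
  rw [contactIntegrand, h₁, h₂, h₃, Real.mul_rpow hr.le hτ.le, Real.mul_rpow hr.le hsin.le,
    Real.mul_rpow (sq_nonneg r) hquad.le]
  linear_combination (r ^ (σ - 1) * (1 + 2 * r * Real.cos θ + r ^ 2) ^ (-Δ) *
    Real.sin θ ^ (4 * Δ - 2) * (τ ^ (σ - 1) *
      (1 + 2 * τ * Real.cos (Real.pi - θ) + τ ^ 2) ^ (-Δ))) * hpow

lemma lintegral_rpow_mul_contactIntegrand_polar (h0 : 0 < σ) (h1 : σ < 2 * Δ) {r θ : ℝ}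
    (hr : 0 < r) (hθ : θ ∈ Set.Ioo 0 Real.pi) :
    ∫⁻ t in Set.Ioi (0 : ℝ), ENNReal.ofReal (t ^ (σ - 1)) * (ENNReal.ofReal r *
        ENNReal.ofReal (contactIntegrand Δ t 0 (-1) (r * Real.cos θ, r * Real.sin θ))) =
      ENNReal.ofReal (r ^ (σ - 1) * (1 + 2 * r * Real.cos θ + r ^ 2) ^ (-Δ)) *
        ENNReal.ofReal (Real.sin θ ^ (4 * Δ - 2) * quadMellin Δ σ (Real.pi - θ)) := by
  have hsin : 0 < Real.sin θ := Real.sin_pos_of_pos_of_lt_pi hθ.1 hθ.2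
  have hcos := neg_one_lt_cos (abs_lt_pi_of_mem_Ioo (pi_sub_mem_Ioo hθ))
  have hquad := one_add_two_mul_cos_add_sq_pos hr.le (neg_one_lt_cos (abs_lt_pi_of_mem_Ioo hθ))
  rw [lintegral_Ioi_eq_mul_lintegral_comp_mul (by unfold contactIntegrand; fun_prop) hr,
    ENNReal.ofReal_mul (p := Real.sin θ ^ (4 * Δ - 2)) (by positivity), ← mul_assoc,
    ← ENNReal.ofReal_mul (by positivity), ← lintegral_rpow_mul_quad_rpow_neg h0 h1 hcos,
    ← lintegral_const_mul' _ _ ENNReal.ofReal_ne_top,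
    ← lintegral_const_mul' _ _ ENNReal.ofReal_ne_top]
  refine setLIntegral_congr_fun measurableSet_Ioi fun τ hτ => ?_
  have hτ0 : 0 < τ := hτ
  rw [← ENNReal.ofReal_mul hr.le, ← ENNReal.ofReal_mul (by positivity),
    ← ENNReal.ofReal_mul hr.le, ← ENNReal.ofReal_mul (by positivity),
    contactIntegrand_polar hr hτ0 hθ]

lemma lintegral_rpow_mul_contactIntegral (h0 : 0 < σ) (h1 : σ < 2 * Δ) :
    ∫⁻ t in Set.Ioi (0 : ℝ), ENNReal.ofReal (t ^ (σ - 1)) * contactIntegral Δ t 0 (-1) =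
      ∫⁻ θ in Set.Ioo 0 Real.pi, ENNReal.ofReal (Real.sin θ ^ (4 * Δ - 2) *
        (quadMellin Δ σ θ * quadMellin Δ σ (Real.pi - θ))) := by
  have hmeas : Measurable fun z : ℝ × ℝ × ℝ => contactIntegrand Δ z.1 0 (-1) z.2 := by
    unfold contactIntegrand
    fun_prop
  have hpolar (t : ℝ) : ENNReal.ofReal (t ^ (σ - 1)) * contactIntegral Δ t 0 (-1) =
      ∫⁻ q in Set.Ioi (0 : ℝ) ×ˢ Set.Ioo 0 Real.pi,
        ENNReal.ofReal (t ^ (σ - 1)) * (ENNReal.ofReal q.1 *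
          ENNReal.ofReal (contactIntegrand Δ t 0 (-1)
            (q.1 * Real.cos q.2, q.1 * Real.sin q.2))) := by
    rw [contactIntegral, lintegral_openHalfPlane_polar,
      lintegral_const_mul' _ _ ENNReal.ofReal_ne_top]
  simp only [hpolar]
  rw [lintegral_lintegral_swap (by fun_prop), Measure.volume_eq_prod, ← Measure.prod_restrict,
    lintegral_prod_symm _ (by fun_prop)]
  refine setLIntegral_congr_fun measurableSet_Ioo fun θ hθ => ?_
  have hcos := neg_one_lt_cos (abs_lt_pi_of_mem_Ioo hθ)
  simp only
  rw [setLIntegral_congr_fun measurableSet_Ioi fun r hr =>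
      lintegral_rpow_mul_contactIntegrand_polar h0 h1 hr hθ,
    lintegral_mul_const' _ _ ENNReal.ofReal_ne_top, lintegral_rpow_mul_quad_rpow_neg h0 h1 hcos,
    ← ENNReal.ofReal_mul (quadMellin_nonneg Δ σ hcos)]
  ring_nf

end PolarMellin

section AngularIntegral

variable {Δ σ : ℝ}

lemma quadMellin_le {θ : ℝ} (h0 : 0 < σ) (h1 : σ < 2 * Δ) (hθ : -1 < Real.cos θ) :
    quadMellin Δ σ θ ≤ ((1 + Real.cos θ) / 2) ^ (-Δ) *
      ∫ τ in Set.Ioi (0 : ℝ), τ ^ (σ - 1) * (1 + τ) ^ (-(2 * Δ)) := by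
  rw [quadMellin, ← integral_const_mul]
  exact setIntegral_mono_on (integrableOn_quadMellin h0 h1 hθ)
    ((integrableOn_rpow_mul_one_add_rpow_neg h0 h1).const_mul _) measurableSet_Ioi
    fun τ hτ => rpow_mul_quad_rpow_neg_le σ (by linarith) hτ hθ le_rfl

lemma sin_rpow_mul_half_angle_rpow_le (hΔ : 1 ≤ Δ) {θ : ℝ} (hθ : θ ∈ Set.Ioo 0 Real.pi) :
    Real.sin θ ^ (4 * Δ - 2) *
      (((1 + Real.cos θ) / 2) ^ (-Δ) * ((1 + Real.cos (Real.pi - θ)) / 2) ^ (-Δ)) ≤ 4 ^ Δ := by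
  have hsin : 0 < Real.sin θ := Real.sin_pos_of_pos_of_lt_pi hθ.1 hθ.2
  have hcos := neg_one_lt_cos (abs_lt_pi_of_mem_Ioo hθ)
  have hcos' := neg_one_lt_cos (abs_lt_pi_of_mem_Ioo (pi_sub_mem_Ioo hθ))
  have hprod : (1 + Real.cos θ) / 2 * ((1 + Real.cos (Real.pi - θ)) / 2) =
      4⁻¹ * Real.sin θ ^ (2 : ℝ) := by
    rw [Real.cos_pi_sub, Real.rpow_two]
    linear_combination -1 / 4 * Real.sin_sq_add_cos_sq θ
  calc
    _ = 4 ^ Δ * Real.sin θ ^ (2 * Δ - 2) := by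
      rw [← Real.mul_rpow (by linarith) (by linarith), hprod,
        Real.mul_rpow (by norm_num) (by positivity), ← Real.rpow_mul hsin.le,
        Real.inv_rpow (by norm_num), Real.rpow_neg (by norm_num : (0 : ℝ) ≤ 4), inv_inv,
        mul_left_comm, ← Real.rpow_add hsin]
      ring_nf
    _ ≤ 4 ^ Δ := mul_le_of_le_one_right (by positivity)
      (Real.rpow_le_one hsin.le (Real.sin_le_one θ) (by linarith))

lemma lintegral_rpow_mul_contactIntegral_lt_top (hΔ : 1 ≤ Δ) (h0 : 0 < σ) (h1 : σ < 2 * Δ) :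
    ∫⁻ t in Set.Ioi (0 : ℝ), ENNReal.ofReal (t ^ (σ - 1)) * contactIntegral Δ t 0 (-1) < ⊤ := by
  set B : ℝ := ∫ τ in Set.Ioi (0 : ℝ), τ ^ (σ - 1) * (1 + τ) ^ (-(2 * Δ))
  have hbound : ∀ θ ∈ Set.Ioo 0 Real.pi, Real.sin θ ^ (4 * Δ - 2) *
      (quadMellin Δ σ θ * quadMellin Δ σ (Real.pi - θ)) ≤ 4 ^ Δ * B ^ 2 := fun θ hθ => by
    have hsin : 0 < Real.sin θ := Real.sin_pos_of_pos_of_lt_pi hθ.1 hθ.2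
    have hcos := neg_one_lt_cos (abs_lt_pi_of_mem_Ioo hθ)
    have hcos' := neg_one_lt_cos (abs_lt_pi_of_mem_Ioo (pi_sub_mem_Ioo hθ))
    have hq := quadMellin_nonneg Δ σ hcos
    have hq' := quadMellin_nonneg Δ σ hcos'
    calc
      _ ≤ Real.sin θ ^ (4 * Δ - 2) * ((((1 + Real.cos θ) / 2) ^ (-Δ) * B) *
          (((1 + Real.cos (Real.pi - θ)) / 2) ^ (-Δ) * B)) := by
        gcongr
        · exact hq.trans (quadMellin_le h0 h1 hcos)
        · exact quadMellin_le h0 h1 hcos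
        · exact quadMellin_le h0 h1 hcos'
      _ = Real.sin θ ^ (4 * Δ - 2) * (((1 + Real.cos θ) / 2) ^ (-Δ) *
          ((1 + Real.cos (Real.pi - θ)) / 2) ^ (-Δ)) * B ^ 2 := by ring
      _ ≤ 4 ^ Δ * B ^ 2 := by
        gcongr
        exact sin_rpow_mul_half_angle_rpow_le hΔ hθ
  rw [lintegral_rpow_mul_contactIntegral h0 h1]
  calc
    _ ≤ ∫⁻ _θ in Set.Ioo 0 Real.pi, ENNReal.ofReal (4 ^ Δ * B ^ 2) :=
      setLIntegral_mono' measurableSet_Ioo fun θ hθ => ENNReal.ofReal_le_ofReal (hbound θ hθ)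
    _ < ⊤ := by
      rw [setLIntegral_const, Real.volume_Ioo]
      exact ENNReal.mul_lt_top ENNReal.ofReal_lt_top ENNReal.ofReal_lt_top

lemma toReal_lintegral_rpow_mul_contactIntegral (N : ℕ) {ν : ℝ} (h0 : 0 < ν) (h1 : ν < 1) :
    (∫⁻ t in Set.Ioi (0 : ℝ),
      ENNReal.ofReal (t ^ (N + 1 - ν - 1)) * contactIntegral (N + 1) t 0 (-1)).toReal =
      (Real.pi / Real.sin (Real.pi * ν) / (4 ^ N * N.factorial)) ^ 2 *
        ∫ θ in (0 : ℝ)..Real.pi, trigSum N ν θ * trigSum N ν (Real.pi - θ) := by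
  set K := Real.pi / Real.sin (Real.pi * ν) / (4 ^ N * N.factorial)
  have hσ0 : 0 < (N : ℝ) + 1 - ν := by linarith [N.cast_nonneg (α := ℝ)]
  have hσ1 : (N : ℝ) + 1 - ν < 2 * (N + 1) := by linarith [N.cast_nonneg (α := ℝ)]
  have hangular : ∀ θ ∈ Set.Ioo 0 Real.pi, Real.sin θ ^ (4 * ((N : ℝ) + 1) - 2) *
      (quadMellin (N + 1) (N + 1 - ν) θ * quadMellin (N + 1) (N + 1 - ν) (Real.pi - θ)) =
      K ^ 2 * (trigSum N ν θ * trigSum N ν (Real.pi - θ)) := fun θ hθ => by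
    have hpow : Real.sin θ ^ (4 * ((N : ℝ) + 1) - 2) =
        Real.sin θ ^ (2 * N + 1) * Real.sin (Real.pi - θ) ^ (2 * N + 1) := by
      rw [Real.sin_pi_sub, ← pow_add, ← Real.rpow_natCast]
      push_cast
      ring_nf
    rw [hpow, mul_mul_mul_comm, sin_pow_mul_quadMellin h0 h1 N hθ,
      sin_pow_mul_quadMellin h0 h1 N (pi_sub_mem_Ioo hθ)]
    ring
  have hnonneg : ∀ θ ∈ Set.Ioo 0 Real.pi, 0 ≤ Real.sin θ ^ (4 * ((N : ℝ) + 1) - 2) *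
      (quadMellin (N + 1) (N + 1 - ν) θ * quadMellin (N + 1) (N + 1 - ν) (Real.pi - θ)) :=
    fun θ hθ => mul_nonneg (Real.rpow_nonneg (Real.sin_pos_of_pos_of_lt_pi hθ.1 hθ.2).le _)
      (mul_nonneg (quadMellin_nonneg _ _ (neg_one_lt_cos (abs_lt_pi_of_mem_Ioo hθ)))
        (quadMellin_nonneg _ _ (neg_one_lt_cos (abs_lt_pi_of_mem_Ioo (pi_sub_mem_Ioo hθ)))))
  rw [lintegral_rpow_mul_contactIntegral hσ0 hσ1,
    setLIntegral_congr_fun measurableSet_Ioo fun θ hθ => by rw [hangular θ hθ],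
    ← integral_eq_lintegral_of_nonneg_ae, integral_const_mul,
    intervalIntegral.integral_of_le Real.pi_pos.le, integral_Ioc_eq_integral_Ioo]
  · filter_upwards [ae_restrict_mem measurableSet_Ioo] with θ hθ
    exact (hnonneg θ hθ).trans_eq (hangular θ hθ)
  · have hcont : Continuous (trigSum N ν) :=
      continuous_iff_continuousAt.mpr fun θ => (hasDerivAt_trigSum N ν θ).continuousAt
    exact Continuous.aestronglyMeasurable (by fun_prop)

end AngularIntegral

section MellinNonneg

open ProbabilityTheory

lemma differentiableOn_mellin_of_nonneg {f : ℝ → ℝ} (hf : Measurable f)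
    (hf0 : ∀ t ∈ Set.Ioi (0 : ℝ), 0 ≤ f t) {a b : ℝ}
    (hconv : ∀ σ ∈ Set.Ioo a b, MellinConvergent (fun t => (f t : ℂ)) σ) :
    DifferentiableOn ℂ (mellin fun t => (f t : ℂ)) {s | s.re ∈ Set.Ioo a b} := by
  -- As a function of `log t`, the Mellin transform of a nonnegative function is a complex moment
  -- generating function.
  set μ : Measure ℝ := (volume.restrict (Set.Ioi 0)).withDensity fun t => ENNReal.ofReal (f t / t)
  have hdensity : ∀ t ∈ Set.Ioi (0 : ℝ), (ENNReal.ofReal (f t / t)).toReal = f t / t :=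
    fun t ht => ENNReal.toReal_ofReal (div_nonneg (hf0 t ht) (le_of_lt ht))
  have hkernel (s : ℂ) : ∀ t ∈ Set.Ioi (0 : ℝ),
      (f t / t) • Complex.exp (s * Real.log t) = (t : ℂ) ^ (s - 1) • (f t : ℂ) := fun t ht => by
    have ht0 : (t : ℂ) ≠ 0 := Complex.ofReal_ne_zero.mpr (ne_of_gt ht)
    rw [Complex.cpow_sub _ _ ht0, Complex.cpow_one, Complex.cpow_def_of_ne_zero ht0,
      Complex.ofReal_log (le_of_lt ht), Complex.real_smul, smul_eq_mul, mul_comm s]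
    push_cast
    ring
  have hmgf : complexMGF Real.log μ = mellin fun t => (f t : ℂ) := funext fun s => by
    rw [complexMGF, integral_withDensity_eq_integral_toReal_smul (by fun_prop)
      (Eventually.of_forall fun _ => ENNReal.ofReal_lt_top)]
    refine setIntegral_congr_fun measurableSet_Ioi fun t ht => ?_
    simp only [hdensity t ht, hkernel s t ht]
  have hexp : Set.Ioo a b ⊆ integrableExpSet Real.log μ := fun σ hσ => by
    refine (integrable_withDensity_iff_integrable_smul' (by fun_prop)
      (Eventually.of_forall fun _ => ENNReal.ofReal_lt_top)).mpr ?_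
    refine (MeasureTheory.Integrable.re (hconv σ hσ)).congr ?_
    filter_upwards [ae_restrict_mem measurableSet_Ioi] with t ht
    simp only [hdensity t ht, ← hkernel σ t ht]
    rw [← Complex.ofReal_mul σ, ← Complex.ofReal_exp, Complex.real_smul, ← Complex.ofReal_mul]
    exact Complex.ofReal_re _
  rw [← hmgf]
  exact differentiableOn_complexMGF.mono fun s hs => interior_maximal hexp isOpen_Ioo hs

variable {F : ℝ → ENNReal}

lemma mellinConvergent_toReal (hF : Measurable F) {s : ℂ}
    (hfin : ∫⁻ t in Set.Ioi (0 : ℝ), ENNReal.ofReal (t ^ (s.re - 1)) * F t < ⊤) :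
    MellinConvergent (fun t => ((F t).toReal : ℂ)) s := by
  refine (mellin_convergent_iff_norm subset_rfl measurableSet_Ioi
    (Measurable.aestronglyMeasurable (by fun_prop))).mpr ?_
  refine (integrableOn_congr_fun (fun t ht => ?_) measurableSet_Ioi).mp
    (integrable_toReal_of_lintegral_ne_top (by fun_prop) hfin.ne)
  simp [ENNReal.toReal_ofReal (Real.rpow_nonneg (le_of_lt (Set.mem_Ioi.mp ht)) _)]

lemma mellin_toReal_ofReal (hF : Measurable F) {σ : ℝ}
    (hfin : ∫⁻ t in Set.Ioi (0 : ℝ), ENNReal.ofReal (t ^ (σ - 1)) * F t < ⊤) :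
    mellin (fun t => ((F t).toReal : ℂ)) σ =
      ((∫⁻ t in Set.Ioi (0 : ℝ), ENNReal.ofReal (t ^ (σ - 1)) * F t).toReal : ℝ) := by
  rw [← integral_toReal (by fun_prop) (ae_lt_top (by fun_prop) hfin.ne),
    ← integral_complex_ofReal, mellin]
  refine setIntegral_congr_fun measurableSet_Ioi fun t ht => ?_
  have ht0 : 0 ≤ t := le_of_lt (Set.mem_Ioi.mp ht)
  simp [ENNReal.toReal_ofReal (Real.rpow_nonneg ht0 _), Complex.ofReal_cpow ht0]

end MellinNonneg

section ReducedMellin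

lemma measurable_contactIntegral (Δ x₂ x₃ : ℝ) :
    Measurable fun t => contactIntegral Δ t x₂ x₃ := by
  unfold contactIntegral contactIntegrand
  exact Measurable.lintegral_prod_right' (f := fun q : ℝ × ℝ × ℝ =>
    ENNReal.ofReal (q.2.2 ^ (4 * Δ - 2) * (((q.2.1 - q.1) ^ 2 + q.2.2 ^ 2) ^ (-Δ) *
      ((q.2.1 - x₂) ^ 2 + q.2.2 ^ 2) ^ (-Δ) * ((q.2.1 - x₃) ^ 2 + q.2.2 ^ 2) ^ (-Δ)))) (by fun_prop)

/-- The ratio of `Dbar Δ` to the contact diagram in `AdS₂`. -/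
noncomputable def contactRatio (Δ : ℝ) : ℝ :=
  2 * Real.Gamma Δ ^ 4 / (√Real.pi * Real.Gamma (2 * Δ - 1 / 2))

lemma Dbar_eq_integral_openTriangle (Δ : ℝ) {t : ℝ} (ht : 0 < t) :
    Dbar Δ (t / (1 + t)) = Real.Gamma Δ ^ 2 * (1 + t) ^ (2 * Δ) * ∫ p in openTriangle,
      p.1 ^ (Δ - 1) * p.2 ^ (Δ - 1) * (1 - p.1 - p.2) ^ (Δ - 1) *
        feynmanForm t 0 (-1) p ^ (-Δ) := by
  have h1t : 0 < 1 + t := by linarith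
  rw [Dbar, DbarUV, ← integral_const_mul]
  refine setIntegral_congr_fun measurableSet_openTriangle fun p hp => ?_
  have hform := feynmanForm_pos ht.ne' (-1) hp
  have hquad : p.1 * (1 - p.1 - p.2) + p.1 * p.2 * (t / (1 + t)) ^ 2 +
      p.2 * (1 - p.1 - p.2) * (1 - t / (1 + t)) ^ 2 = feynmanForm t 0 (-1) p / (1 + t) ^ 2 := by
    unfold feynmanForm
    field_simp
    ring
  have hpow : ((1 + t) ^ 2) ^ Δ = (1 + t) ^ (2 * Δ) := by
    rw [← Real.rpow_natCast, ← Real.rpow_mul h1t.le, Nat.cast_ofNat]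
  simp only [show (Δ + Δ + Δ + Δ) / 2 - Δ = Δ by ring]
  rw [hquad, Real.div_rpow hform.le (by positivity), hpow, Real.rpow_neg hform.le,
    div_div_eq_mul_div]
  ring

lemma Dbar_eq_contactIntegral {Δ : ℝ} (hΔ : 1 / 4 < Δ) {t : ℝ} (ht : 0 < t) :
    Dbar Δ (t / (1 + t)) =
      contactRatio Δ * (1 + t) ^ (2 * Δ) * (contactIntegral Δ t 0 (-1)).toReal := by
  have : 0 < Real.Gamma Δ := Real.Gamma_pos_of_pos (by linarith)
  have hΓ' : 0 < Real.Gamma (2 * Δ - 1 / 2) := Real.Gamma_pos_of_pos (by linarith)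
  have : 0 < √Real.pi := Real.sqrt_pos.mpr Real.pi_pos
  rw [contactIntegral_eq_lintegral_openTriangle hΔ ht.ne', ENNReal.toReal_mul,
    ENNReal.toReal_ofReal (by positivity), Dbar_eq_integral_openTriangle Δ ht,
    integral_eq_lintegral_of_nonneg_ae, contactRatio]
  · generalize Real.Gamma (2 * Δ - 1 / 2) = G at hΓ'
    field_simp
  · filter_upwards [ae_restrict_mem measurableSet_openTriangle] with p hp
    have hform := feynmanForm_pos ht.ne' (-1) hp
    have hp₁ : 0 < p.1 := hp.1
    have hp₂ : 0 < p.2 := hp.2.1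
    have hp₃ := one_sub_sub_pos_of_mem_openTriangle hp
    simp only [Pi.zero_apply]
    positivity
  · unfold feynmanForm
    exact Measurable.aestronglyMeasurable (by fun_prop)

variable {Δ : ℕ}

lemma DbarIntegrand_eq_contactIntegral (hΔ : 0 < Δ) {t : ℝ} (ht : 0 < t) :
    DbarIntegrand Δ t = (contactRatio Δ : ℂ) •
      ((t : ℂ) ^ (2 * Δ : ℂ) • ((contactIntegral Δ t 0 (-1)).toReal : ℂ)) := by
  have hΔ1 : (1 : ℝ) ≤ Δ := by exact_mod_cast hΔ
  have : 0 < 1 + t := by linarith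
  have hcpow : (t : ℂ) ^ (2 * Δ : ℂ) = ((t ^ (2 * Δ) : ℝ) : ℂ) := by
    rw [← Nat.cast_ofNat, ← Nat.cast_mul, Complex.cpow_natCast, Complex.ofReal_pow]
  have hrpow : (1 + t) ^ (2 * (Δ : ℝ)) = (1 + t) ^ (2 * Δ) := by
    rw [← Nat.cast_ofNat, ← Nat.cast_mul, Real.rpow_natCast]
  rw [hcpow, DbarIntegrand, Dbar_eq_contactIntegral (by linarith) ht, hrpow, smul_eq_mul,
    smul_eq_mul, ← Complex.ofReal_mul, ← Complex.ofReal_mul, div_pow]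
  congr 1
  field_simp

lemma mellinConvergent_contactIntegral (hΔ : 0 < Δ) {s : ℂ} (h0 : 0 < s.re)
    (h1 : s.re < 2 * Δ) :
    MellinConvergent (fun t => ((contactIntegral Δ t 0 (-1)).toReal : ℂ)) s :=
  mellinConvergent_toReal (measurable_contactIntegral Δ 0 (-1))
    (lintegral_rpow_mul_contactIntegral_lt_top (by exact_mod_cast hΔ) h0 h1)

lemma mellinConvergent_DbarIntegrand (hΔ : 0 < Δ) {s : ℂ} (h0 : 0 < s.re)
    (h1 : s.re < 2 * Δ) : MellinConvergent (DbarIntegrand Δ) (-s) := by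
  have hre : (-s + 2 * Δ).re = 2 * Δ - s.re := by simp; ring
  have h := (MellinConvergent.cpow_smul.mpr (mellinConvergent_contactIntegral hΔ
    (s := -s + 2 * Δ) (by linarith) (by linarith))).const_smul (contactRatio Δ : ℂ)
  refine (integrableOn_congr_fun (fun t ht => ?_) measurableSet_Ioi).mp h
  simp only [DbarIntegrand_eq_contactIntegral hΔ ht]

lemma Mhat_eq_mellin_contactIntegral (hΔ : 0 < Δ) (s : ℂ) :
    Mhat Δ s = contactRatio Δ *
      mellin (fun t => ((contactIntegral Δ t 0 (-1)).toReal : ℂ)) (2 * Δ - s) := by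
  rw [Mhat, sub_eq_neg_add, ← mellin_cpow_smul, ← smul_eq_mul, ← mellin_const_smul]
  refine setIntegral_congr_fun measurableSet_Ioi fun t ht => ?_
  simp only [DbarIntegrand_eq_contactIntegral hΔ ht]

lemma differentiableOn_Mhat (hΔ : 0 < Δ) :
    DifferentiableOn ℂ (Mhat Δ) {s | s.re ∈ Set.Ioo 0 (2 * Δ : ℝ)} := by
  have hmellin := differentiableOn_mellin_of_nonneg
    (measurable_contactIntegral Δ 0 (-1)).ennreal_toReal (fun _ _ => ENNReal.toReal_nonneg)
    (a := 0) (b := 2 * Δ) fun σ hσ =>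
      mellinConvergent_contactIntegral hΔ (s := σ) (by simpa using hσ.1) (by simpa using hσ.2)
  rw [show Mhat Δ = _ from funext (Mhat_eq_mellin_contactIntegral hΔ)]
  refine (hmellin.comp (by fun_prop) fun s hs => ?_).const_mul _
  obtain ⟨h0, h1⟩ := hs
  have hre : (2 * (Δ : ℂ) - s).re = 2 * Δ - s.re := by simp
  exact ⟨by linarith, by linarith⟩

end ReducedMellin

section ClosedFormula

open Polynomial

lemma sqrt_pi_mul_Gamma_nat_add_half (n : ℕ) :
    √Real.pi * Real.Gamma (n + 1 / 2) = Real.pi * n.factorial * n.centralBinom / 4 ^ n := by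
  induction n with
  | zero => simp [-one_div, Real.Gamma_one_half_eq, Real.mul_self_sqrt Real.pi_pos.le]
  | succ n ih =>
    have hrec : ((n : ℝ) + 1) * (n + 1).centralBinom = 2 * (2 * n + 1) * n.centralBinom := by
      exact_mod_cast n.succ_mul_centralBinom_succ
    rw [Nat.cast_succ, add_right_comm, Real.Gamma_add_one (by positivity), mul_left_comm, ih,
      Nat.factorial_succ, Nat.cast_mul, Nat.cast_succ, pow_succ]
    field_simp
    linear_combination -2 * hrec

lemma contactPoly_eq_C_contactRatio_mul_trigNormSq (N : ℕ) :
    contactPoly N = C (contactRatio ((N + 1 : ℕ) : ℝ) * Real.pi / (2 * (4 ^ N * N.factorial) ^ 2)) *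
      trigNormSq N := by
  have hΓ := sqrt_pi_mul_Gamma_nat_add_half (2 * N + 1)
  have hchoose : ((2 * N + 1).centralBinom : ℝ) ≠ 0 := by
    exact_mod_cast (2 * N + 1).centralBinom_ne_zero
  rw [contactPoly_eq_C_mul_trigNormSq, contactRatio,
    show 2 * ((N + 1 : ℕ) : ℝ) - 1 / 2 = (2 * N + 1 : ℕ) + 1 / 2 by push_cast; ring, hΓ,
    Nat.cast_succ, Real.Gamma_nat_eq_factorial, ← Nat.centralBinom]
  congr 2
  field_simp
  ring

lemma Mhat_ofReal (N : ℕ) {ν : ℝ} (h0 : 0 < ν) (h1 : ν < 1) :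
    Mhat (N + 1) (N + 1 + ν : ℝ) = ((-1) ^ N * Real.pi / Real.sin (Real.pi * ν) ^ 2 *
      (Real.sin (Real.pi * ν) *
          ∑ n ∈ Finset.range (2 * N + 1), (contactPoly N).eval (n - N : ℝ) / (ν - (n - N)) -
        Real.pi * Real.cos (Real.pi * ν) * (contactPoly N).eval ν) : ℝ) := by
  have hν : ∀ m : ℤ, ν ≠ m := by
    rintro m rfl
    norm_cast at h0 h1
    omega
  have hcast : 2 * ((N + 1 : ℕ) : ℂ) - (N + 1 + ν : ℝ) = (N + 1 - ν : ℝ) := by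
    push_cast
    ring
  have : 0 ≤ (N : ℝ) := N.cast_nonneg
  rw [Mhat_eq_mellin_contactIntegral N.succ_pos, hcast,
    mellin_toReal_ofReal (measurable_contactIntegral _ _ _)
      (lintegral_rpow_mul_contactIntegral_lt_top (by simp) (by linarith)
        (by push_cast; linarith)), Nat.cast_succ,
    toReal_lintegral_rpow_mul_contactIntegral N h0 h1, integral_trigSum_mul_trigSum_pi_sub N hν,
    ← Complex.ofReal_mul]
  simp only [contactPoly_eq_C_contactRatio_mul_trigNormSq, eval_mul, eval_C, mul_div_assoc _
    (Polynomial.eval _ _), ← Finset.mul_sum, Nat.cast_succ]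
  congr 1
  field_simp

lemma PDelta_succ_eq_sum (N : ℕ) (s : ℂ) :
    PDelta (N + 1) s = ∑ n ∈ Finset.range (N + 1), (contactPolyCoeff N n : ℂ) *
      ((ascPochhammer ℂ n).eval (2 * (N + 1 : ℕ) - s) * (ascPochhammer ℂ n).eval s) := by
  rw [PDelta, Finset.mul_sum]
  refine Finset.sum_congr rfl fun n hn => ?_
  have hnN : n ≤ N := Finset.mem_range_succ_iff.mp hn
  have hΓ₁ : Complex.Gamma (2 * n + 1) = (2 * n).factorial := by
    exact_mod_cast Complex.Gamma_nat_eq_factorial (2 * n)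
  have hΓ₂ : Complex.Gamma (N + 1 : ℕ) = N.factorial := by
    exact_mod_cast Complex.Gamma_nat_eq_factorial N
  have hΓ₃ : Complex.Gamma ((N + 1 : ℕ) + n) = (N + n).factorial := by
    rw [← Complex.Gamma_nat_eq_factorial]
    push_cast
    ring_nf
  have hΓ₄ : Complex.Gamma ((N + 1 : ℕ) - n) = (N - n).factorial := by
    rw [← Complex.Gamma_nat_eq_factorial]
    push_cast [hnN]
    ring_nf
  have hΓ₅ : Complex.Gamma (2 * ((N + 1 : ℕ) + n)) = (2 * (N + n) + 1).factorial := by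
    rw [← Complex.Gamma_nat_eq_factorial]
    push_cast
    ring_nf
  rw [hΓ₁, hΓ₂, hΓ₃, hΓ₄, hΓ₅, Complex.Gamma_nat_eq_factorial, contactPolyCoeff]
  push_cast
  ring

lemma ascPochhammer_eval_mul_eval_eq_wilsonBasis (N n : ℕ) (s : ℂ) :
    (ascPochhammer ℂ n).eval (2 * (N + 1 : ℕ) - s) * (ascPochhammer ℂ n).eval s =
      ((wilsonBasis N n).map Complex.ofRealHom).eval (s - (N + 1 : ℕ)) := by
  induction n with
  | zero => simp [wilsonBasis]
  | succ n ih =>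
    rw [ascPochhammer_succ_eval, ascPochhammer_succ_eval, mul_mul_mul_comm, ih, wilsonBasis,
      wilsonBasis, Finset.prod_range_succ, Polynomial.map_mul, eval_mul]
    congr 1
    simp
    ring

lemma PDelta_succ_eq_eval (N : ℕ) (s : ℂ) :
    PDelta (N + 1) s = ((contactPoly N).map Complex.ofRealHom).eval (s - (N + 1 : ℕ)) := by
  simp only [PDelta_succ_eq_sum, ascPochhammer_eval_mul_eval_eq_wilsonBasis, contactPoly,
    Polynomial.map_sum, Polynomial.map_mul, map_C, eval_finsetSum, eval_mul, eval_C,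
    Complex.ofRealHom_eq_coe]

lemma PDelta_ofReal (N : ℕ) (ν : ℝ) :
    PDelta (N + 1) (N + 1 + ν : ℝ) = ((contactPoly N).eval ν : ℝ) := by
  rw [PDelta_succ_eq_eval, show ((N + 1 + ν : ℝ) : ℂ) - (N + 1 : ℕ) = Complex.ofRealHom ν by
    simp, eval_map, eval₂_at_apply, Complex.ofRealHom_eq_coe]

lemma sum_PDelta_div_ofReal (N : ℕ) (ν : ℝ) :
    ∑ k ∈ Finset.Icc 1 (2 * (N + 1) - 1), PDelta (N + 1) k / ((N + 1 + ν : ℝ) - k : ℂ) =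
      (∑ n ∈ Finset.range (2 * N + 1), (contactPoly N).eval (n - N : ℝ) / (ν - (n - N)) : ℝ) := by
  rw [show 2 * (N + 1) - 1 = 2 * N + 1 by omega, ← Finset.Ico_add_one_right_eq_Icc,
    Finset.sum_Ico_eq_sum_range, Complex.ofReal_sum]
  refine Finset.sum_congr (by simp) fun n _ => ?_
  have hcast : ((1 + n : ℕ) : ℂ) = (N + 1 + (n - N) : ℝ) := by
    push_cast
    ring
  rw [hcast, PDelta_ofReal, ← Complex.ofReal_sub, add_sub_add_left_eq_sub, Complex.ofReal_div]

lemma MhatClosed_ofReal (N : ℕ) {ν : ℝ} (hν : Real.sin (Real.pi * ν) ≠ 0) :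
    MhatClosed (N + 1) (N + 1 + ν : ℝ) = ((-1) ^ N * Real.pi / Real.sin (Real.pi * ν) ^ 2 *
      (Real.sin (Real.pi * ν) *
          ∑ n ∈ Finset.range (2 * N + 1), (contactPoly N).eval (n - N : ℝ) / (ν - (n - N)) -
        Real.pi * Real.cos (Real.pi * ν) * (contactPoly N).eval ν) : ℝ) := by
  have hshift : Real.pi * (N + 1 + ν) = Real.pi * ν + (N + 1 : ℕ) * Real.pi := by
    push_cast
    ring
  rw [MhatClosed, Complex.cot, ← Complex.ofReal_mul, ← Complex.ofReal_sin, ← Complex.ofReal_cos,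
    hshift, Real.sin_add_nat_mul_pi, Real.cos_add_nat_mul_pi, sum_PDelta_div_ofReal, PDelta_ofReal]
  simp only [← Complex.ofReal_mul, ← Complex.ofReal_div, ← Complex.ofReal_sub]
  congr 1
  rcases neg_one_pow_eq_or ℝ N with hsign | hsign <;> rw [pow_succ, hsign] <;> field_simp <;> ring

lemma Mhat_eq_MhatClosed_ofReal (N : ℕ) {ν : ℝ} (h0 : 0 < ν) (h1 : ν < 1) :
    Mhat (N + 1) (N + 1 + ν : ℝ) = MhatClosed (N + 1) (N + 1 + ν : ℝ) := by
  have hsin : 0 < Real.sin (Real.pi * ν) :=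
    Real.sin_pos_of_pos_of_lt_pi (by positivity) (by nlinarith [Real.pi_pos])
  rw [Mhat_ofReal N h0 h1, MhatClosed_ofReal N hsin.ne']

end ClosedFormula

section Continuation

lemma eventuallyEq_nhdsNE_of_meromorphicOn {𝕜 E : Type*} [NontriviallyNormedField 𝕜]
    [NormedAddCommGroup E] [NormedSpace 𝕜 E] {f g : 𝕜 → E} {U : Set 𝕜} (hf : MeromorphicOn f U)
    (hg : MeromorphicOn g U) (hU : IsPreconnected U) {x y : 𝕜} (hx : x ∈ U) (hy : y ∈ U)
    (hfreq : ∃ᶠ z in 𝓝[≠] x, f z = g z) : f =ᶠ[𝓝[≠] y] g := by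
  have heq := ((hf x hx).frequently_eq_iff_eventuallyEq (hg x hx)).mp hfreq
  have hx_top : meromorphicOrderAt (f - g) x = ⊤ :=
    meromorphicOrderAt_eq_top_iff.mpr (eventuallyEq_iff_sub.mp heq)
  have hy_top : meromorphicOrderAt (f - g) y = ⊤ := by
    by_contra hne
    exact (hf.sub hg).meromorphicOrderAt_ne_top_of_isPreconnected hU hy hx hne hx_top
  exact eventuallyEq_iff_sub.mpr (meromorphicOrderAt_eq_top_iff.mp hy_top)

variable {Δ : ℕ}

lemma differentiable_PDelta (Δ : ℕ) : Differentiable ℂ (PDelta Δ) := by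
  unfold PDelta
  fun_prop

lemma meromorphicAt_MhatClosed (Δ : ℕ) (s : ℂ) : MeromorphicAt (MhatClosed Δ) s := by
  have hP : MeromorphicAt (PDelta Δ) s := (differentiable_PDelta Δ).analyticAt s |>.meromorphicAt
  unfold MhatClosed Complex.cot
  fun_prop

lemma continuousAt_MhatClosed (Δ : ℕ) {s : ℂ} (hs : ∀ m : ℤ, s ≠ m) :
    ContinuousAt (MhatClosed Δ) s := by
  have hP := (differentiable_PDelta Δ).continuous
  have hsin : Complex.sin (Real.pi * s) ≠ 0 := sin_pi_mul_ne_zero fun ⟨m, hm⟩ => hs m hm.symm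
  have hsub : ∀ k : ℕ, s - k ≠ 0 := fun k => sub_ne_zero.mpr (by simpa using hs k)
  unfold MhatClosed Complex.cot
  fun_prop (disch := first | assumption | exact hsub _)

lemma MhatClosed_eventuallyEq_Mhat (hΔ : 0 < Δ) {s : ℂ} (h0 : 0 < s.re) (h1 : s.re < 2 * Δ) :
    MhatClosed Δ =ᶠ[𝓝[≠] s] Mhat Δ := by
  obtain ⟨N, rfl⟩ := Nat.exists_eq_succ_of_ne_zero hΔ.ne'
  set U : Set ℂ := {z | z.re ∈ Set.Ioo 0 (2 * (N + 1 : ℕ) : ℝ)}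
  have hUo : IsOpen U := isOpen_Ioo.preimage Complex.continuous_re
  have hUc : IsPreconnected U :=
    ((convex_Ioo _ _).linear_preimage Complex.reLm).isPreconnected
  have : 0 ≤ (N : ℝ) := N.cast_nonneg
  obtain ⟨x₀, hx₀_left, hx₀_right⟩ := exists_between (show (N : ℝ) + 1 < N + 2 by simp)
  have hx₀ : (x₀ : ℂ) ∈ U :=
    ⟨by rw [Complex.ofReal_re]; linarith, by rw [Complex.ofReal_re]; push_cast; linarith⟩
  refine eventuallyEq_nhdsNE_of_meromorphicOn (fun z _ => meromorphicAt_MhatClosed _ z)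
    ((differentiableOn_Mhat hΔ).analyticOnNhd hUo).meromorphicOn hUc hx₀ ⟨h0, h1⟩ ?_
  have hofReal : Tendsto Complex.ofReal (𝓝[≠] x₀) (𝓝[≠] (x₀ : ℂ)) :=
    Complex.continuous_ofReal.continuousAt.continuousWithinAt.tendsto_nhdsWithin
      fun x hx => by simpa using hx
  refine hofReal.frequently (Eventually.frequently (eventually_nhdsWithin_of_eventually_nhds ?_))
  filter_upwards [Ioo_mem_nhds hx₀_left hx₀_right] with x hx
  rw [← add_sub_cancel ((N : ℝ) + 1) x]
  exact (Mhat_eq_MhatClosed_ofReal N (by linarith [hx.1]) (by linarith [hx.2])).symm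

lemma continuousAt_Mhat (hΔ : 0 < Δ) {s : ℂ} (h0 : 0 < s.re) (h1 : s.re < 2 * Δ) :
    ContinuousAt (Mhat Δ) s :=
  (differentiableOn_Mhat hΔ).continuousOn.continuousAt
    ((isOpen_Ioo.preimage Complex.continuous_re).mem_nhds ⟨h0, h1⟩)

theorem tendsto_MhatClosed (hΔ : 0 < Δ) {s : ℂ} (h0 : 0 < s.re) (h1 : s.re < 2 * Δ) :
    Tendsto (MhatClosed Δ) (𝓝[≠] s) (𝓝 (Mhat Δ s)) :=
  ((continuousAt_Mhat hΔ h0 h1).tendsto.mono_left nhdsWithin_le_nhds).congr'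
    (MhatClosed_eventuallyEq_Mhat hΔ h0 h1).symm

theorem Mhat_eq_MhatClosed (hΔ : 0 < Δ) {s : ℂ} (h0 : 0 < s.re) (h1 : s.re < 2 * Δ)
    (hs : ∀ m : ℤ, s ≠ m) : Mhat Δ s = MhatClosed Δ s :=
  tendsto_nhds_unique (tendsto_MhatClosed hΔ h0 h1)
    ((continuousAt_MhatClosed Δ hs).tendsto.mono_left nhdsWithin_le_nhds)

end Continuation

section Hypergeometric

lemma Gamma_add_natCast_ascPochhammer {z : ℂ} (hz : ∀ m : ℕ, z ≠ -m) (n : ℕ) :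
    Complex.Gamma (z + n) = Complex.Gamma z * (ascPochhammer ℂ n).eval z := by
  rw [← Complex.Gamma_add_nat_div_Gamma_eq z hz, mul_div_cancel₀ _ (Complex.Gamma_ne_zero hz)]

lemma ne_neg_natCast_of_re_pos {z : ℂ} (hz : 0 < z.re) (m : ℕ) : z ≠ -m := by
  rintro rfl
  simp only [Complex.neg_re, Complex.natCast_re] at hz
  linarith [m.cast_nonneg (α := ℝ)]

lemma prod_Gamma_mul_regularizedHGFunCoeff (a : Multiset ℂ) {b : Multiset ℂ}
    (hb : ∀ z ∈ b, ∀ m : ℕ, z ≠ -m) (n : ℕ) :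
    (b.map Complex.Gamma).prod * Complex.regularizedHGFunCoeff a b n =
      (a.map (ascPochhammer ℂ n).eval).prod /
        (n.factorial * (b.map (ascPochhammer ℂ n).eval).prod) := by
  have hΓ : (b.map Complex.Gamma).prod ≠ 0 := by
    simpa [Multiset.prod_eq_zero_iff] using fun z hz => Complex.Gamma_ne_zero (hb z hz)
  rw [Complex.regularizedHGFunCoeff, Multiset.map_congr rfl fun z hz =>
    Gamma_add_natCast_ascPochhammer (hb z hz) n, Multiset.prod_map_mul]
  field_simp

lemma hypergeometricF_eq_sum_of_neg_natCast_mem {a b : Multiset ℂ} {N : ℕ}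
    (ha : -(N : ℂ) ∈ a) (hb : ∀ z ∈ b, ∀ m : ℕ, z ≠ -m) (x : ℂ) :
    hypergeometricF a b x = ∑ n ∈ Finset.range (N + 1),
      (a.map (ascPochhammer ℂ n).eval).prod /
        (n.factorial * (b.map (ascPochhammer ℂ n).eval).prod) * x ^ n := by
  have hsum : Complex.regularizedHGFun a b x =
      ∑ n ∈ Finset.range (N + 1), Complex.regularizedHGFunCoeff a b n * x ^ n := by
    refine (FormalMultilinearSeries.ofScalars_sum_eq _ x).trans (tsum_eq_sum fun n hn => ?_)
    rw [Complex.regularizedHGFunCoeff_eq_zero_left a b n N ha (by simpa using hn), zero_smul]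
  rw [hypergeometricF, hsum, Finset.mul_sum]
  simp_rw [← prod_Gamma_mul_regularizedHGFunCoeff a hb, mul_assoc]

lemma contactPolyCoeff_mul_ascPochhammer {N n : ℕ} (hn : n ≤ N) :
    (contactPolyCoeff N n : ℂ) *
        (n.factorial ^ 3 * (ascPochhammer ℂ n).eval ((N + 1 : ℕ) + 1 / 2 : ℂ)) =
      contactPolyCoeff N 0 *
        ((ascPochhammer ℂ n).eval (1 / 2) * (ascPochhammer ℂ n).eval (-N : ℂ)) := by
  induction n with
  | zero => simp
  | succ n ih =>
    have hrec : (contactPolyCoeff N (n + 1) : ℂ) * ((n + 1) ^ 3 * (2 * N + 2 * n + 3)) =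
        contactPolyCoeff N n * ((2 * n + 1) * (n - N)) := by
      exact_mod_cast congrArg Complex.ofReal (contactPolyCoeff_succ hn)
    have ih := ih (by omega)
    simp only [ascPochhammer_succ_eval, Nat.factorial_succ]
    push_cast at ih ⊢
    linear_combination (1 / 2 * n.factorial ^ 3 *
      (ascPochhammer ℂ n).eval ((N + 1 : ℂ) + 1 / 2)) * hrec +
      ((n + 1 / 2) * (n - N)) * ih

lemma contactPolyCoeff_zero (N : ℕ) :
    (contactPolyCoeff N 0 : ℂ) =
      2 * (Complex.Gamma (N + 1 : ℕ) ^ 4 / Complex.Gamma (2 * (N + 1 : ℕ))) := by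
  have hΓ : Complex.Gamma (2 * (N + 1 : ℕ)) = (2 * N + 1).factorial := by
    rw [← Complex.Gamma_nat_eq_factorial]; push_cast; ring_nf
  have hN : (N.factorial : ℂ) ≠ 0 := by exact_mod_cast N.factorial_ne_zero
  rw [hΓ, Nat.cast_succ, Complex.Gamma_nat_eq_factorial, contactPolyCoeff]
  simp
  field_simp

theorem PDelta_succ_eq_hypergeometricF (N : ℕ) (s : ℂ) :
    PDelta (N + 1) s =
      2 * (Complex.Gamma (N + 1 : ℕ) ^ 4 / Complex.Gamma (2 * (N + 1 : ℕ))) *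
        hypergeometricF {1 / 2, s, 1 - ((N + 1 : ℕ) : ℂ), 2 * (N + 1 : ℕ) - s}
          {1, 1, ((N + 1 : ℕ) : ℂ) + 1 / 2} 1 := by
  have hhalf : 0 < (((N + 1 : ℕ) : ℂ) + 1 / 2).re := by
    rw [Complex.add_re, Complex.natCast_re]
    norm_num
    positivity
  have hb : ∀ z ∈ ({1, 1, ((N + 1 : ℕ) : ℂ) + 1 / 2} : Multiset ℂ), ∀ m : ℕ, z ≠ -m := by
    refine fun z hz => ne_neg_natCast_of_re_pos ?_
    simp only [Multiset.insert_eq_cons, Multiset.mem_cons, Multiset.mem_singleton] at hz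
    rcases hz with rfl | rfl | rfl <;> first | exact hhalf | simp
  rw [PDelta_succ_eq_sum, ← contactPolyCoeff_zero,
    hypergeometricF_eq_sum_of_neg_natCast_mem (N := N) (by simp) hb, Finset.mul_sum]
  refine Finset.sum_congr rfl fun n hn => ?_
  have hcoeff := contactPolyCoeff_mul_ascPochhammer (Finset.mem_range_succ_iff.mp hn)
  have hasc : (ascPochhammer ℂ n).eval (((N + 1 : ℕ) : ℂ) + 1 / 2) ≠ 0 := by
    rw [Ne, ascPochhammer_eval_eq_zero_iff]
    rintro ⟨k, -, hk⟩
    exact ne_neg_natCast_of_re_pos hhalf k (by rw [hk, neg_neg])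
  have hN : 1 - ((N + 1 : ℕ) : ℂ) = -N := by push_cast; ring
  simp only [Multiset.insert_eq_cons, Multiset.map_cons, Multiset.map_singleton,
    Multiset.prod_cons, Multiset.prod_singleton, ascPochhammer_eval_one, one_pow, mul_one, hN]
  have := n.factorial_ne_zero
  rw [mul_div_assoc', eq_div_iff (by positivity)]
  linear_combination ((ascPochhammer ℂ n).eval (2 * ((N + 1 : ℕ) : ℂ) - s) *
    (ascPochhammer ℂ n).eval s) * hcoeff

end Hypergeometric

section Degree

open Polynomial

lemma degree_wilsonBasis (N n : ℕ) : (wilsonBasis N n).degree = (2 * n : ℕ) := by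
  have hfactor (k : ℕ) : (C ((N + 1 + k : ℝ) ^ 2) - X ^ 2 : ℝ[X]).degree = (2 : ℕ) := by
    rw [← neg_sub, degree_neg, degree_X_pow_sub_C two_pos]
  simp only [wilsonBasis, degree_prod, hfactor, Finset.sum_const, Finset.card_range, nsmul_eq_mul]
  norm_cast
  rw [mul_comm]

lemma degree_contactPoly (N : ℕ) : (contactPoly N).degree = (2 * N : ℕ) := by
  have hcoeff : contactPolyCoeff N N ≠ 0 := by
    rw [contactPolyCoeff]
    positivity
  have htop : (C (contactPolyCoeff N N) * wilsonBasis N N).degree = (2 * N : ℕ) := by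
    rw [degree_C_mul hcoeff, degree_wilsonBasis]
  rw [contactPoly, Finset.sum_range_succ, degree_add_eq_right_of_degree_lt, htop]
  rw [htop]
  refine (degree_sum_le _ _).trans_lt ((Finset.sup_lt_iff (WithBot.bot_lt_coe _)).mpr ?_)
  refine fun n hn => (degree_C_mul_le_of_le _ (degree_wilsonBasis N n).le).trans_lt ?_
  exact_mod_cast Nat.mul_lt_mul_of_pos_left (Finset.mem_range.mp hn) two_pos

theorem exists_polynomial_PDelta_succ (N : ℕ) :
    ∃ p : ℂ[X], p.degree = ((2 * (N + 1) - 2 : ℕ) : WithBot ℕ) ∧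
      ∀ s : ℂ, PDelta (N + 1) s = p.eval s := by
  refine ⟨taylor (-((N + 1 : ℕ) : ℂ)) ((contactPoly N).map Complex.ofRealHom), ?_, fun s => ?_⟩
  · rw [degree_taylor, degree_map, degree_contactPoly, Nat.mul_succ, Nat.add_sub_cancel]
  · rw [PDelta_succ_eq_eval, taylor_eval, sub_eq_add_neg]

end Degree

section Correlator

lemma hasMellin_finsetSum {ι : Type*} {S : Finset ι} {F : ι → ℝ → ℂ} {s : ℂ}
    (h : ∀ i ∈ S, MellinConvergent (F i) s) :
    HasMellin (fun t => ∑ i ∈ S, F i t) s (∑ i ∈ S, mellin (F i) s) := by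
  constructor
  · simp only [MellinConvergent, Finset.smul_sum]
    exact integrable_finsetSum _ h
  · simp only [mellin, Finset.smul_sum]
    exact integral_finsetSum _ h

lemma hasMellin_congr_Ioi {f g : ℝ → ℂ} {s m : ℂ} (h : HasMellin f s m)
    (hfg : ∀ t : ℝ, 0 < t → f t = g t) : HasMellin g s m := by
  have heq : Set.EqOn (fun t : ℝ => (t : ℂ) ^ (s - 1) • f t)
      (fun t : ℝ => (t : ℂ) ^ (s - 1) • g t) (Set.Ioi 0) := fun t ht => by
    simp only [hfg t ht]
  exact ⟨(integrableOn_congr_fun heq measurableSet_Ioi).1 h.1,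
    (setIntegral_congr_fun measurableSet_Ioi heq).symm.trans h.2⟩

lemma two_mul_cCoeff {k L : ℕ} (hk : k ≤ 2 * L) :
    2 * cCoeff k L = (2 * L).choose k + (if k = 0 then 1 else 0) +
      (if k = 2 * L then 1 else 0) := by
  have h1 : Real.Gamma (2 * L + 1) = (2 * L).factorial := by
    exact_mod_cast Real.Gamma_nat_eq_factorial (2 * L)
  have h2 : Real.Gamma (2 * L - k + 1) = (2 * L - k).factorial := by
    rw [← Real.Gamma_nat_eq_factorial]
    push_cast [hk]
    rfl
  rw [cCoeff, h1, h2, Real.Gamma_nat_eq_factorial, Nat.cast_choose ℝ hk]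
  ring

lemma sum_cCoeff_mul_pow (L : ℕ) (x : ℝ) :
    ∑ k ∈ Finset.range (2 * L + 1), 2 * cCoeff k L * x ^ k =
      (1 + x) ^ (2 * L) + 1 + x ^ (2 * L) := by
  have hcoeff : ∀ k ∈ Finset.range (2 * L + 1), 2 * cCoeff k L * x ^ k =
      x ^ k * (2 * L).choose k + (if k = 0 then x ^ k else 0) +
        (if k = 2 * L then x ^ k else 0) := fun k hk => by
    rw [two_mul_cCoeff (Finset.mem_range_succ_iff.mp hk)]
    split_ifs <;> ring
  rw [Finset.sum_congr rfl hcoeff, Finset.sum_add_distrib, Finset.sum_add_distrib, add_comm 1 x,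
    add_pow]
  simp

lemma contactCorrelator_eq_sum (Δ L : ℕ) {t : ℝ} (ht : 0 < t) :
    (contactCorrelator Δ L (t / (1 + t)) : ℂ) = ∑ k ∈ Finset.range (2 * L + 1),
      2 * contactNorm Δ L * cCoeff k L * ((t : ℂ) ^ (-(k : ℂ)) * DbarIntegrand (Δ + L) t) := by
  have hsum : (∑ k ∈ Finset.range (2 * L + 1), 2 * cCoeff k L * t⁻¹ ^ k) *
      (t / (1 + t)) ^ (2 * L) = 1 + (t / (1 + t)) ^ (2 * L) + (1 - t / (1 + t)) ^ (2 * L) := by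
    rw [sum_cCoeff_mul_pow, add_mul, add_mul, one_mul, ← mul_pow, ← mul_pow,
      show (1 + t⁻¹) * (t / (1 + t)) = 1 by field_simp; ring,
      show t⁻¹ * (t / (1 + t)) = 1 - t / (1 + t) by field_simp; ring, one_pow]
  simp only [contactCorrelator, DbarIntegrand, ← hsum, Complex.cpow_neg, Complex.cpow_natCast,
    mul_add 2, pow_add]
  norm_cast
  rw [Finset.sum_mul, Finset.mul_sum, Finset.sum_mul]
  refine Finset.sum_congr rfl fun k _ => ?_
  rw [inv_pow]
  ring

theorem hasMellin_contactCorrelator {Δ : ℕ} (L : ℕ) {s : ℂ} (hΔ : 0 < Δ) (h0 : 0 < s.re)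
    (h1 : s.re < 2 * Δ) :
    HasMellin (fun t : ℝ => ((contactCorrelator Δ L (t / (1 + t)) : ℝ) : ℂ)) (-s)
      (2 * contactNorm Δ L *
        ∑ k ∈ Finset.range (2 * L + 1), (cCoeff k L : ℂ) * Mhat (Δ + L) (s + k)) := by
  have hterm : ∀ k ∈ Finset.range (2 * L + 1), HasMellin (fun t : ℝ =>
      (2 * contactNorm Δ L * cCoeff k L : ℂ) • ((t : ℂ) ^ (-(k : ℂ)) • DbarIntegrand (Δ + L) t))
      (-s) (2 * contactNorm Δ L * cCoeff k L * Mhat (Δ + L) (s + k)) := by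
    intro k hk
    have hk : (k : ℝ) ≤ 2 * L := by exact_mod_cast Finset.mem_range_succ_iff.mp hk
    have hconv : MellinConvergent (DbarIntegrand (Δ + L)) (-(s + k)) := by
      apply mellinConvergent_DbarIntegrand (by omega)
      · rw [Complex.add_re, Complex.natCast_re]
        positivity
      · rw [Complex.add_re, Complex.natCast_re]
        push_cast
        linarith
    rw [neg_add] at hconv
    refine ⟨(MellinConvergent.cpow_smul.mpr hconv).const_smul _, ?_⟩
    rw [mellin_const_smul, mellin_cpow_smul, Mhat, neg_add, smul_eq_mul]
  have hsum := hasMellin_finsetSum fun k hk => (hterm k hk).1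
  rw [Finset.sum_congr rfl fun k hk => (hterm k hk).2] at hsum
  rw [Finset.mul_sum]
  simp only [← mul_assoc]
  exact hasMellin_congr_Ioi hsum fun t ht => (contactCorrelator_eq_sum Δ L ht).symm

end Correlator

theorem mainTheorem4 (Δ : ℕ) (hΔ : 0 < Δ) :
    -- the Mellin integral converges in the strip and is given by the closed formula
    (∀ s : ℂ, 0 < s.re → s.re < 2 * Δ →
      MellinConvergent (DbarIntegrand Δ) (-s) ∧
        ((∀ m : ℤ, s ≠ m) → Mhat Δ s = MhatClosed Δ s)) ∧
    -- at the integers of the strip the singularities of the closed formula are removable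
    (∀ m ∈ Finset.Icc 1 (2 * Δ - 1),
      Tendsto (MhatClosed Δ) (𝓝[≠] (m : ℂ)) (𝓝 (Mhat Δ m))) ∧
    -- `P_Δ` is a terminating `₄F₃` and a polynomial of degree `2Δ - 2`
    (∀ s : ℂ, PDelta Δ s =
      2 * (Complex.Gamma Δ ^ 4 / Complex.Gamma (2 * Δ)) *
        hypergeometricF {1 / 2, s, 1 - (Δ : ℂ), 2 * Δ - s} {1, 1, (Δ : ℂ) + 1 / 2} 1) ∧
    (∃ p : Polynomial ℂ, p.degree = ((2 * Δ - 2 : ℕ) : WithBot ℕ) ∧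
      ∀ s : ℂ, PDelta Δ s = p.eval s) ∧
    -- the Mellin transform of the correlator with `4L` derivatives
    (∀ (L : ℕ) (s : ℂ), 0 < s.re → s.re < 2 * Δ →
      HasMellin (fun t : ℝ => ((contactCorrelator Δ L (t / (1 + t)) : ℝ) : ℂ)) (-s)
        (2 * contactNorm Δ L *
          ∑ k ∈ Finset.range (2 * L + 1), (cCoeff k L : ℂ) * Mhat (Δ + L) (s + k))) := by
  obtain ⟨N, rfl⟩ := Nat.exists_eq_succ_of_ne_zero hΔ.ne'
  refine ⟨fun s h0 h1 => ⟨mellinConvergent_DbarIntegrand hΔ h0 h1, Mhat_eq_MhatClosed hΔ h0 h1⟩,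
    fun m hm => ?_, PDelta_succ_eq_hypergeometricF N, exists_polynomial_PDelta_succ N,
    fun L s => hasMellin_contactCorrelator L hΔ⟩
  obtain ⟨hm_pos, hm_le⟩ := Finset.mem_Icc.mp hm
  refine tendsto_MhatClosed hΔ ?_ ?_ <;> rw [Complex.natCast_re]
  · exact_mod_cast hm_pos
  · exact_mod_cast (show m < 2 * (N + 1) by omega)
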